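/- Let $N,n$ be positive integers and, for $\xi\in\mathbb{R}^{N\times n}$, let $|\xi|=(\sum_{i,j}\xi_{ij}^2)^{1/2}$. For $1\le p<\infty$, a Borel measurable function $f:\mathbb{R}^{N\times n}\to\mathbb{R}$ that is bounded below is called $W^{1,p}$-quasiconvex if for every $\xi\in\mathbb{R}^{N\times n}$ there is a nonempty bounded open set $\Omega\subset\mathbb{R}^n$ whose boundary has Lebesgue measure zero such that $$\int_\Omega f(\xi+\nabla\phi(x))\,dx\ \ge\ |\Omega|\,f(\xi)\qquad\text{for all }\phi\in W^{1,p}_0(\Omega;\mathbb{R}^N),$$ where $W^{1,p}_0(\Omega;\mathbb{R}^N)$ is the closure of $C_c^\infty(\Omega;\mathbb{R}^N)$ in $W^{1,p}(\Omega;\mathbb{R}^N)$, $|\Omega|$ is the Lebesgue measure of $\Omega$, and the integral may take the value $+\infty$. **Theorem.** Let $1\le p<2$ and let $f:\mathbb{R}^{N\times n}\to\mathbb{R}$ be continuous, bounded below and $W^{1,p}$-quasiconvex. Suppose that there is a constant $L\in\mathbb{R}$ such that $$f(\xi)\le L(1+|\xi|)\qquad\text{for all }\xi\in\mathbb{R}^{N\times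 n}\text{ with }\operatorname{rank}(\xi)\le 1.$$ Then there is a constant $L'\in\mathbb{R}$ such that $f(\xi)\le L'(1+|\xi|)$ for all $\xi\in\mathbb{R}^{N\times n}$. Moreover, $f$ is $W^{1,1}$-quasiconvex. -/

import Mathlib

open MeasureTheory Set
open scoped ENNReal ContDiff

/-- The Euclidean norm `|ξ| = (∑ᵢⱼ ξᵢⱼ²)^{1/2}` on `ℝ^{N×n}`. -/
noncomputable def matrixNorm {n N : ℕ} (ξ : Matrix (Fin N) (Fin n) ℝ) : ℝ :=
  √(∑ i, ∑ j, ξ i j ^ 2)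

/-- The classical gradient (Jacobian matrix) `(∇ψ(x))ᵢⱼ = ∂ψᵢ/∂xⱼ (x)` of a map
`ψ : ℝⁿ → ℝᴺ`. It is only used for smooth maps. -/
noncomputable def jacobian {n N : ℕ}
    (ψ : EuclideanSpace ℝ (Fin n) → EuclideanSpace ℝ (Fin N))
    (x : EuclideanSpace ℝ (Fin n)) : Matrix (Fin N) (Fin n) ℝ :=
  Matrix.of fun i j => (fderiv ℝ ψ x (EuclideanSpace.single j 1)) i

/-- `ψ ∈ C_c^∞(Ω; F)`: smooth on `ℝⁿ` with compact support contained in `Ω`. -/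
structure IsTestMap {n : ℕ} {F : Type*} [NormedAddCommGroup F] [NormedSpace ℝ F]
    (Ω : Set (EuclideanSpace ℝ (Fin n))) (ψ : EuclideanSpace ℝ (Fin n) → F) : Prop where
  smooth : ContDiff ℝ ∞ ψ
  compactSupport : HasCompactSupport ψ
  tsupport_subset : tsupport ψ ⊆ Ω

/-- `G` is a weak (distributional) gradient of `φ` on `Ω`:
`∫_Ω φᵢ ∂ⱼη dx = - ∫_Ω Gᵢⱼ η dx` for all scalar test functions `η ∈ C_c^∞(Ω)`. -/
structure IsWeakGradient {n N : ℕ} (Ω : Set (EuclideanSpace ℝ (Fin n)))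
    (φ : EuclideanSpace ℝ (Fin n) → EuclideanSpace ℝ (Fin N))
    (G : EuclideanSpace ℝ (Fin n) → Matrix (Fin N) (Fin n) ℝ) : Prop where
  locallyIntegrableOn : LocallyIntegrableOn φ Ω
  locallyIntegrableOn_gradient : ∀ (i : Fin N) (j : Fin n),
    LocallyIntegrableOn (fun x => G x i j) Ω
  integral_eq : ∀ η : EuclideanSpace ℝ (Fin n) → ℝ, IsTestMap Ω η →
    ∀ (i : Fin N) (j : Fin n),
      ∫ x in Ω, φ x i * fderiv ℝ η x (EuclideanSpace.single j 1) = - ∫ x in Ω, G x i j * η x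

/-- `φ ∈ W^{1,p}(Ω; ℝᴺ)`, with weak gradient `∇φ = G` (which is unique up to null sets). -/
structure MemW1p {n N : ℕ} (p : ℝ≥0∞) (Ω : Set (EuclideanSpace ℝ (Fin n)))
    (φ : EuclideanSpace ℝ (Fin n) → EuclideanSpace ℝ (Fin N))
    (G : EuclideanSpace ℝ (Fin n) → Matrix (Fin N) (Fin n) ℝ) : Prop where
  memLp : MemLp φ p (volume.restrict Ω)
  memLp_gradient : ∀ (i : Fin N) (j : Fin n), MemLp (fun x => G x i j) p (volume.restrict Ω)
  isWeakGradient : IsWeakGradient Ω φ G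

/-- `φ ∈ W^{1,p}_0(Ω; ℝᴺ)` for `1 ≤ p < ∞`, with weak gradient `∇φ = G`: `φ` lies in the
closure of `C_c^∞(Ω; ℝᴺ)` in `W^{1,p}(Ω; ℝᴺ)`. -/
structure MemW1pZero {n N : ℕ} (p : ℝ≥0∞) (Ω : Set (EuclideanSpace ℝ (Fin n)))
    (φ : EuclideanSpace ℝ (Fin n) → EuclideanSpace ℝ (Fin N))
    (G : EuclideanSpace ℝ (Fin n) → Matrix (Fin N) (Fin n) ℝ) : Prop where
  memW1p : MemW1p p Ω φ G
  exists_approx : ∀ ε : ℝ≥0∞, 0 < ε →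
    ∃ ψ : EuclideanSpace ℝ (Fin n) → EuclideanSpace ℝ (Fin N), IsTestMap Ω ψ ∧
      eLpNorm (φ - ψ) p (volume.restrict Ω) < ε ∧
      ∀ (i : Fin N) (j : Fin n),
        eLpNorm (fun x => G x i j - jacobian ψ x i j) p (volume.restrict Ω) < ε

/-- The extended-valued Lebesgue integral `∫ g⁺ dμ - ∫ g⁻ dμ ∈ [-∞, ∞]`. It is only used for
functions bounded below on sets of finite measure, so that `∫ g⁻ dμ < ∞` and the value `+∞` is
attained exactly when `∫ g⁺ dμ = ∞`. -/
noncomputable def extIntegral {α : Type*} [MeasurableSpace α] (μ : Measure α) (g : α → ℝ) :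
    EReal :=
  ((∫⁻ x, ENNReal.ofReal (g x) ∂μ : ℝ≥0∞) : EReal)
    - ((∫⁻ x, ENNReal.ofReal (- g x) ∂μ : ℝ≥0∞) : EReal)

/-- `f` satisfies the `W^{1,p}`-quasiconvexity inequality at `ξ` (for `1 ≤ p < ∞`): for some
nonempty bounded open `Ω` with Lebesgue-null boundary,
`∫_Ω f(ξ + ∇φ) dx ≥ |Ω| f(ξ)` for all `φ ∈ W^{1,p}_0(Ω; ℝᴺ)`. -/
def IsW1pQuasiconvexAt {n N : ℕ} (p : ℝ≥0∞) (f : Matrix (Fin N) (Fin n) ℝ → ℝ)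
    (ξ : Matrix (Fin N) (Fin n) ℝ) : Prop :=
  ∃ Ω : Set (EuclideanSpace ℝ (Fin n)), Ω.Nonempty ∧ Bornology.IsBounded Ω ∧ IsOpen Ω ∧
    volume (frontier Ω) = 0 ∧
    ∀ (φ : EuclideanSpace ℝ (Fin n) → EuclideanSpace ℝ (Fin N))
      (G : EuclideanSpace ℝ (Fin n) → Matrix (Fin N) (Fin n) ℝ), MemW1pZero p Ω φ G →
      ((volume.real Ω * f ξ : ℝ) : EReal)
        ≤ extIntegral (volume.restrict Ω) fun x => f (ξ + G x)

/-- `W^{1,p}`-quasiconvexity (for `1 ≤ p < ∞`) of a real-valued integrand: `f` is Borel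
measurable, bounded below, and `W^{1,p}`-quasiconvex at every matrix. -/
structure IsW1pQuasiconvex {n N : ℕ} (p : ℝ≥0∞) (f : Matrix (Fin N) (Fin n) ℝ → ℝ) :
    Prop where
  measurable : Measurable[borel (Matrix (Fin N) (Fin n) ℝ)] f
  bddBelow : BddBelow (range f)
  quasiconvexAt : ∀ ξ, IsW1pQuasiconvexAt p f ξ

/-! ### A family of coalescing dyadic roundings -/

/-! If `n ≤ 1`, every matrix has rank at most one. If `n ≥ 2`, the heart of the matter is a map of a
ball onto a set of one-dimensional pieces: it equals the identity on the boundary sphere, its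
gradient has rank at most one almost everywhere, and that gradient lies in `L^p` for every `p < 2`,
with an `L^1` mean bounded independently of the ball. Composing with `ξ` gives an admissible
competitor whose total gradient `ξ * M` has rank at most one. Quasiconvexity bounds `f ξ` by the
mean of `f (ξ * M)`, and the growth on rank-one matrices makes this mean at most linear in `ξ`.

The map replaces each shifted coordinate `y = x i - θ i` by a staircase in `y`. With sharp jumps the
staircase is `(1/2) ∫ sign (y - c_h v) dv` over `[-R, R]`, where `c_h = coalescing h` collects the
reals into clusters of size comparable to `h`. Since `c_0` is the identity, so is the staircase at
`h = 0`; letting `h` be the distance to the sphere therefore gives the identity as boundary values.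
Each jump moves at speed at most one as `h` varies, so the varying scale costs only a bounded
factor.

Sharp jumps would not be Sobolev, so each is widened to a ramp of half-width `σ`, half of the second
smallest distance (the gap) of the coordinates to their jumps. All coordinates but one are then
outside the ramps and locally constant, which gives rank at most one (`hasFDerivAt_foldCoord`,
`rank_one_add_jacobian_foldDisp_le`), and the gradient is at most a multiple of `h / gap` plus a
constant (`norm_fderiv_foldCoord_le`). The gap is small only where two coordinates are near jumps
simultaneously, a set of codimension two; averaging over independent shifts `θ i` turns this into
integrability of `(h / gap) ^ p` for `p < 2` (`lintegral_div_jumpGap_rpow_le`).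

Once linear growth is known, the quasiconvexity inequality for smooth test maps passes to
`W^{1,1}_0` by dominated convergence. -/

lemma abs_ciInf_sub_ciInf_le {ι : Type*} [Nonempty ι] {f g : ι → ℝ} {C : ℝ}
    (hf : BddBelow (range f)) (hg : BddBelow (range g)) (h : ∀ i, |f i - g i| ≤ C) :
    |(⨅ i, f i) - ⨅ i, g i| ≤ C := by
  rw [abs_sub_le_iff]
  constructor
  · have : (⨅ i, f i) - C ≤ ⨅ i, g i := le_ciInf fun i => by
      have h1 := ciInf_le hf i
      have h2 := (abs_sub_le_iff.1 (h i)).1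
      linarith
    linarith
  · have : (⨅ i, g i) - C ≤ ⨅ i, f i := le_ciInf fun i => by
      have h1 := ciInf_le hg i
      have h2 := (abs_sub_le_iff.1 (h i)).2
      linarith
    linarith

/-- The largest multiple of `2 ^ i` that is at most `v`. -/
noncomputable def dyadicFloor (i : ℤ) (v : ℝ) : ℝ := 2 ^ i * ⌊v / 2 ^ i⌋

lemma dyadicFloor_le (i : ℤ) (v : ℝ) : dyadicFloor i v ≤ v := by
  have h2 : (0 : ℝ) < 2 ^ i := by positivity
  have := Int.floor_le (v / 2 ^ i)
  rw [le_div_iff₀ h2] at this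
  rw [dyadicFloor]; linarith

lemma lt_dyadicFloor_add (i : ℤ) (v : ℝ) : v < dyadicFloor i v + 2 ^ i := by
  have h2 : (0 : ℝ) < 2 ^ i := by positivity
  have := Int.lt_floor_add_one (v / 2 ^ i)
  rw [div_lt_iff₀ h2] at this
  rw [dyadicFloor]; linarith

lemma two_zpow_eq_nat_mul {i k : ℤ} (hik : i ≤ k) : ∃ m : ℕ, 0 < m ∧ (2 : ℝ) ^ k = m * 2 ^ i := by
  refine ⟨2 ^ (k - i).toNat, by positivity, ?_⟩
  have : k = ((k - i).toNat : ℤ) + i := by omega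
  conv_lhs => rw [this]
  rw [zpow_add₀ (by norm_num), zpow_natCast]; push_cast; rfl

lemma dyadicFloor_anti {i k : ℤ} (hik : i ≤ k) (v : ℝ) : dyadicFloor k v ≤ dyadicFloor i v := by
  obtain ⟨m, -, hm⟩ := two_zpow_eq_nat_mul hik
  have h2 : (0 : ℝ) < 2 ^ i := by positivity
  have h1 := dyadicFloor_le k v
  rw [dyadicFloor, hm] at h1
  have h3 : ((m * ⌊v / 2 ^ k⌋ : ℤ) : ℝ) ≤ v / 2 ^ i := by
    rw [le_div_iff₀ h2]; push_cast; rw [hm]; linarith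
  have h4 : ((m * ⌊v / 2 ^ k⌋ : ℤ) : ℝ) ≤ ⌊v / 2 ^ i⌋ := by exact_mod_cast Int.le_floor.2 h3
  rw [dyadicFloor, dyadicFloor]
  calc (2 : ℝ) ^ k * ⌊v / 2 ^ k⌋ = 2 ^ i * ((m * ⌊v / 2 ^ k⌋ : ℤ) : ℝ) := by
        push_cast; rw [hm]; ring
    _ ≤ _ := by gcongr

lemma dyadicFloor_congr {i k : ℤ} (hik : k ≤ i) {u v : ℝ} (h : ⌊u / 2 ^ k⌋ = ⌊v / 2 ^ k⌋) :
    dyadicFloor i u = dyadicFloor i v := by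
  obtain ⟨m, -, hm⟩ := two_zpow_eq_nat_mul hik
  rw [dyadicFloor, dyadicFloor]
  have : ∀ w : ℝ, ⌊w / 2 ^ i⌋ = ⌊w / 2 ^ k⌋ / (m : ℤ) := fun w => by
    rw [← Int.floor_div_natCast, hm, div_div, mul_comm]
  rw [this, this, h]

/-- At scale `h` all reals are moved to a discrete set of mesh comparable to `h`; the fibres of
these maps grow with `h`, and the image of each point is `1`-Lipschitz in `h`. -/
noncomputable def coalescing (h v : ℝ) : ℝ := ⨅ i : ℤ, (dyadicFloor i v + |h - 2 ^ i|)

lemma bddBelow_coalescing (h v : ℝ) :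
    BddBelow (range fun i : ℤ => dyadicFloor i v + |h - 2 ^ i|) := by
  refine ⟨v - h, ?_⟩
  rintro _ ⟨i, rfl⟩
  have h1 := lt_dyadicFloor_add i v
  have h2 := neg_abs_le (h - 2 ^ i)
  simp only; linarith

lemma coalescing_zero (v : ℝ) : coalescing 0 v = v := by
  have habs : ∀ i : ℤ, |(0 : ℝ) - 2 ^ i| = 2 ^ i := fun i => by
    rw [zero_sub, abs_neg, abs_of_pos (by positivity)]
  apply le_antisymm
  · refine le_of_forall_pos_le_add fun ε hε => ?_
    obtain ⟨k, hk, -⟩ := exists_mem_Ico_zpow hε (one_lt_two)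
    refine (ciInf_le (bddBelow_coalescing 0 v) k).trans ?_
    rw [habs]
    exact add_le_add (dyadicFloor_le k v) hk
  · refine le_ciInf fun i => ?_
    rw [habs]; exact (lt_dyadicFloor_add i v).le

lemma abs_coalescing_sub_le (h h' v : ℝ) : |coalescing h v - coalescing h' v| ≤ |h - h'| := by
  refine abs_ciInf_sub_ciInf_le (bddBelow_coalescing h v) (bddBelow_coalescing h' v) fun i => ?_
  rw [add_sub_add_left_eq_sub]
  refine (abs_abs_sub_abs_le _ _).trans ?_
  rw [sub_sub_sub_cancel_right]

lemma abs_coalescing_sub_self_le (h v : ℝ) : |coalescing h v - v| ≤ |h| := by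
  simpa [coalescing_zero] using abs_coalescing_sub_le h 0 v

lemma measurable_coalescing (h : ℝ) : Measurable (coalescing h) := by
  refine Measurable.iInf fun i => ?_
  unfold dyadicFloor
  fun_prop

/-- Scales `i ≤ k` never beat `k`: passing from `i` to `k` lowers both the dyadic floor and the
penalty, because `2 ^ i ≤ 2 ^ k ≤ h`. Only scales `i ≥ k` matter, and these see a point only through
its dyadic interval of length `2 ^ k`. -/
lemma coalescing_le_of_floor_eq {h : ℝ} {k : ℤ} (hk : (2 : ℝ) ^ k ≤ h) {u v : ℝ}
    (huv : ⌊u / 2 ^ k⌋ = ⌊v / 2 ^ k⌋) : coalescing h u ≤ coalescing h v := by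
  refine le_ciInf fun i => ?_
  rcases le_total k i with hi | hi
  · rw [← dyadicFloor_congr hi huv]; exact ciInf_le (bddBelow_coalescing h u) i
  · refine (ciInf_le (bddBelow_coalescing h u) k).trans ?_
    have h1 : (2 : ℝ) ^ i ≤ 2 ^ k := zpow_le_zpow_right₀ one_le_two hi
    rw [abs_of_nonneg (by linarith), abs_of_nonneg (by linarith), dyadicFloor_congr le_rfl huv]
    have := dyadicFloor_anti hi v
    linarith

/-- A fibre contains a whole dyadic interval of length `2 ^ k`, where `2 ^ k ≤ h < 2 ^ (k + 1)`.
This is what bounds the density of the jumps at scale `h`. -/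
lemma le_volume_fiber_coalescing {h : ℝ} (hh : 0 < h) (v : ℝ) :
    ENNReal.ofReal (h / 2) ≤ volume {u | coalescing h u = coalescing h v} := by
  obtain ⟨k, hk, hk'⟩ := exists_mem_Ico_zpow hh (one_lt_two)
  have h2 : (0 : ℝ) < 2 ^ k := by positivity
  have hsub : Ico (dyadicFloor k v) (dyadicFloor k v + 2 ^ k) ⊆
      {u | coalescing h u = coalescing h v} := by
    intro u hu
    have : ⌊u / 2 ^ k⌋ = ⌊v / 2 ^ k⌋ := by
      rw [Int.floor_eq_iff, le_div_iff₀ h2, div_lt_iff₀ h2]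
      have h3 := hu.1
      have h4 := hu.2
      rw [dyadicFloor] at h3 h4
      constructor <;> linarith
    exact le_antisymm (coalescing_le_of_floor_eq hk this) (coalescing_le_of_floor_eq hk this.symm)
  refine le_trans ?_ (measure_mono hsub)
  rw [Real.volume_Ico]
  apply ENNReal.ofReal_le_ofReal
  rw [zpow_add_one₀ (by norm_num)] at hk'
  linarith

/-! ### Distance to the discrete image -/

/-- The distance from `y` to the image of `coalescing h`. -/
noncomputable def jumpDist (y h : ℝ) : ℝ := ⨅ v, |y - coalescing h v|

lemma bddBelow_jumpDist (y h : ℝ) : BddBelow (range fun v => |y - coalescing h v|) :=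
  ⟨0, by rintro _ ⟨v, rfl⟩; exact abs_nonneg _⟩

lemma jumpDist_nonneg (y h : ℝ) : 0 ≤ jumpDist y h := le_ciInf fun _ => abs_nonneg _

lemma jumpDist_le_abs_sub (y h v : ℝ) : jumpDist y h ≤ |y - coalescing h v| :=
  ciInf_le (bddBelow_jumpDist y h) v

lemma jumpDist_le (y h : ℝ) : jumpDist y h ≤ |h| :=
  (jumpDist_le_abs_sub y h y).trans (by rw [abs_sub_comm]; exact abs_coalescing_sub_self_le h y)

lemma abs_jumpDist_sub_le (y y' h h' : ℝ) :
    |jumpDist y h - jumpDist y' h'| ≤ |y - y'| + |h - h'| := by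
  refine abs_ciInf_sub_ciInf_le (bddBelow_jumpDist y h) (bddBelow_jumpDist y' h') fun v => ?_
  refine (abs_abs_sub_abs_le _ _).trans ?_
  have : y - coalescing h v - (y' - coalescing h' v) =
    (y - y') - (coalescing h v - coalescing h' v) := by ring
  rw [this]
  exact (abs_sub _ _).trans (add_le_add le_rfl (abs_coalescing_sub_le _ _ _))

lemma continuous_jumpDist : Continuous fun z : ℝ × ℝ => jumpDist z.1 z.2 := by
  refine (LipschitzWith.of_dist_le_mul (K := 2) fun z w => ?_).continuous
  rw [Real.dist_eq]
  refine (abs_jumpDist_sub_le _ _ _ _).trans ?_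
  have h1 : |z.1 - w.1| ≤ dist z w := le_max_left _ _
  have h2 : |z.2 - w.2| ≤ dist z w := le_max_right _ _
  push_cast; linarith

/-! ### Smoothed staircases -/

/-- The retraction of `ℝ` onto `[-1, 1]`. -/
noncomputable def unitClamp (t : ℝ) : ℝ := max (-1) (min t 1)

lemma abs_unitClamp_le (t : ℝ) : |unitClamp t| ≤ 1 := by
  rw [abs_le, unitClamp]
  exact ⟨le_max_left _ _, max_le (by norm_num) (min_le_right _ _)⟩

lemma unitClamp_of_one_le {t : ℝ} (h : 1 ≤ t) : unitClamp t = 1 := by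
  rw [unitClamp, min_eq_right h]; norm_num

lemma unitClamp_of_le_neg_one {t : ℝ} (h : t ≤ -1) : unitClamp t = -1 := by
  rw [unitClamp, min_eq_left (by linarith), max_eq_left h]

lemma unitClamp_of_mem {t : ℝ} (h : -1 ≤ t) (h' : t ≤ 1) : unitClamp t = t := by
  rw [unitClamp, min_eq_left h', max_eq_right h]

lemma unitClamp_neg (t : ℝ) : unitClamp (-t) = - unitClamp t := by
  rcases le_total t (-1) with h | h
  · rw [unitClamp_of_le_neg_one h, unitClamp_of_one_le (by linarith)]; norm_num
  rcases le_total t 1 with h' | h'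
  · rw [unitClamp_of_mem h h', unitClamp_of_mem (by linarith) (by linarith)]
  · rw [unitClamp_of_one_le h', unitClamp_of_le_neg_one (by linarith)]

lemma abs_unitClamp_sub_le (t t' : ℝ) : |unitClamp t - unitClamp t'| ≤ |t - t'| := by
  rw [unitClamp, unitClamp]
  refine (abs_max_sub_max_le_max _ _ _ _).trans ?_
  rw [sub_self, abs_zero]
  refine max_le (abs_nonneg _) ((abs_min_sub_min_le_max _ _ _ _).trans ?_)
  rw [sub_self, abs_zero]
  exact max_le le_rfl (abs_nonneg _)

lemma continuous_unitClamp : Continuous unitClamp := by unfold unitClamp; fun_prop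

/-- The denominator on the right involves only one of the two windows. This asymmetry lets the later
local estimates avoid any lower bound on the nearby window `σ'`. -/
lemma abs_unitClamp_div_sub_div_le_of_nonneg {u : ℝ} (hu : 0 ≤ u) {σ σ' : ℝ} (hσ : 0 < σ)
    (hσ' : 0 < σ') : |unitClamp (u / σ) - unitClamp (u / σ')| ≤ |σ - σ'| / σ := by
  have hin : ∀ τ : ℝ, 0 < τ → u < τ → unitClamp (u / τ) = u / τ := fun τ hτ h =>
    unitClamp_of_mem (by linarith [div_nonneg hu hτ.le]) ((div_le_one hτ).2 h.le)
  have hout : ∀ τ : ℝ, 0 < τ → τ ≤ u → unitClamp (u / τ) = 1 := fun τ hτ h =>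
    unitClamp_of_one_le ((one_le_div hτ).2 h)
  rw [le_div_iff₀ hσ, ← abs_of_pos hσ, ← abs_mul, abs_of_pos hσ, sub_mul]
  rcases le_or_gt σ u with h | h <;> rcases le_or_gt σ' u with h' | h'
  · rw [hout _ hσ h, hout _ hσ' h', sub_self, abs_zero]; positivity
  · rw [hout _ hσ h, hin _ hσ' h', abs_sub_comm σ, abs_of_nonneg (by linarith : 0 ≤ σ' - σ)]
    have h1 : u / σ' * σ ≤ σ := by
      rw [div_mul_eq_mul_div, div_le_iff₀ hσ']; nlinarith
    -- After multiplication by `σ'` this is `(2σ - σ')σ' ≤ σ² ≤ uσ`, whose first half is `(σ' - σ)²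
    -- ≥ 0`.
    have h2 : σ - (σ' - σ) ≤ u / σ' * σ := by
      rw [div_mul_eq_mul_div, le_div_iff₀ hσ']; nlinarith [mul_nonneg hσ.le (sub_nonneg.2 h), sq_nonneg (σ' - σ)]
    rw [abs_le]; constructor <;> linarith
  · rw [hin _ hσ h, hout _ hσ' h', div_mul_cancel₀ _ hσ.ne', abs_of_nonneg (by linarith : 0 ≤ σ - σ'),
      abs_le]
    constructor <;> linarith
  · rw [hin _ hσ h, hin _ hσ' h', div_mul_cancel₀ _ hσ.ne']
    have h3 : u - u / σ' * σ = u / σ' * (σ' - σ) := by field_simp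
    rw [h3, abs_mul, abs_of_nonneg (div_nonneg hu hσ'.le), abs_sub_comm]
    exact mul_le_of_le_one_left (abs_nonneg _) ((div_le_one hσ').2 h'.le)

lemma abs_unitClamp_div_sub_div_le (u : ℝ) {σ σ' : ℝ} (hσ : 0 < σ) (hσ' : 0 < σ') :
    |unitClamp (u / σ) - unitClamp (u / σ')| ≤ |σ - σ'| / σ := by
  rcases le_total 0 u with hu | hu
  · exact abs_unitClamp_div_sub_div_le_of_nonneg hu hσ hσ'
  · have := abs_unitClamp_div_sub_div_le_of_nonneg (neg_nonneg.2 hu) hσ hσ'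
    rw [neg_div, neg_div, unitClamp_neg, unitClamp_neg] at this
    rwa [← abs_neg, neg_sub']

lemma abs_unitClamp_div_sub_div_le_add (u u' : ℝ) {σ σ' : ℝ} (hσ : 0 < σ) (hσ' : 0 < σ') :
    |unitClamp (u / σ) - unitClamp (u' / σ')| ≤ (|u - u'| + |σ - σ'|) / σ := by
  have h1 : |unitClamp (u / σ) - unitClamp (u' / σ)| ≤ |u - u'| / σ :=
    (abs_unitClamp_sub_le _ _).trans (by rw [← sub_div, abs_div, abs_of_pos hσ])
  have h2 := abs_unitClamp_div_sub_div_le u' hσ hσ'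
  rw [add_div]
  exact (abs_sub_le _ _ _).trans (add_le_add h1 h2)

/-- If `u` stays farther from `0` than the windows involved, the clamped quotient is constant. -/
lemma unitClamp_div_eq_of_abs_sub_le {u u' σ σ' : ℝ} (hσ : 0 < σ) (hσ' : 0 < σ')
    (h : |u - u'| + |σ - σ'| ≤ |u| - σ) : unitClamp (u / σ) = unitClamp (u' / σ') := by
  have h1 := abs_le.1 (le_refl |u - u'|)
  have h2 := abs_le.1 (le_refl |σ - σ'|)
  have h3 := abs_nonneg (u - u')
  rcases le_total 0 u with hu | hu
  · rw [abs_of_nonneg hu] at h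
    rw [unitClamp_of_one_le, unitClamp_of_one_le]
    · rw [one_le_div hσ']; linarith
    · rw [one_le_div hσ]; linarith [abs_nonneg (σ - σ')]
  · rw [abs_of_nonpos hu] at h
    rw [unitClamp_of_le_neg_one, unitClamp_of_le_neg_one]
    · rw [div_le_iff₀ hσ']; linarith
    · rw [div_le_iff₀ hσ]; linarith [abs_nonneg (σ - σ')]

/-- The staircase with jumps at the image of `coalescing h`, smoothed over windows of
half-width `σ`. -/
noncomputable def smoothStep (R y h σ : ℝ) : ℝ :=
  (1 / 2) * ∫ v in Icc (-R) R, unitClamp ((y - coalescing h v) / σ)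

lemma measurable_unitClamp_coalescing (y h σ : ℝ) :
    Measurable fun v => unitClamp ((y - coalescing h v) / σ) :=
  continuous_unitClamp.measurable.comp
    ((measurable_const.sub (measurable_coalescing h)).div_const σ)

lemma integrableOn_unitClamp_coalescing (R y h σ : ℝ) :
    IntegrableOn (fun v => unitClamp ((y - coalescing h v) / σ)) (Icc (-R) R) :=
  Measure.integrableOn_of_bounded (M := 1) (by simp)
    (measurable_unitClamp_coalescing y h σ).aestronglyMeasurable
    (Filter.Eventually.of_forall fun _ => abs_unitClamp_le _)

lemma abs_smoothStep_le {R : ℝ} (hR : 0 ≤ R) (y h σ : ℝ) : |smoothStep R y h σ| ≤ R := by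
  have := norm_setIntegral_le_of_norm_le_const (μ := volume) (s := Icc (-R) R) (C := 1)
    (f := fun v => unitClamp ((y - coalescing h v) / σ)) (by simp) (fun _ _ => abs_unitClamp_le _)
  rw [Real.norm_eq_abs, measureReal_def, Real.volume_Icc, ENNReal.toReal_ofReal (by linarith)] at this
  rw [smoothStep, abs_mul, abs_of_pos (by norm_num)]
  linarith

lemma smoothStep_sub (R y h σ y' h' σ' : ℝ) :
    smoothStep R y h σ - smoothStep R y' h' σ' = (1 / 2) * ∫ v in Icc (-R) R,
      (unitClamp ((y - coalescing h v) / σ) - unitClamp ((y' - coalescing h' v) / σ')) := by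
  rw [smoothStep, smoothStep, ← mul_sub,
    integral_sub (integrableOn_unitClamp_coalescing ..) (integrableOn_unitClamp_coalescing ..)]

lemma abs_sub_coalescing_sub_le (y h y' h' v : ℝ) :
    |y - coalescing h v - (y' - coalescing h' v)| ≤ |y - y'| + |h - h'| := by
  have : y - coalescing h v - (y' - coalescing h' v) =
    (y - y') - (coalescing h v - coalescing h' v) := by ring
  rw [this]
  exact (abs_sub _ _).trans (add_le_add le_rfl (abs_coalescing_sub_le _ _ _))

/-- A crude bound that integrates over all of `[-R, R]`. It serves only to show that the regularised
maps are globally Lipschitz, so its constant is irrelevant. -/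
lemma abs_smoothStep_sub_le {R δ : ℝ} (hR : 0 ≤ R) (hδ : 0 < δ) (y h y' h' : ℝ) {σ σ' : ℝ}
    (hσ : δ ≤ σ) (hσ' : δ ≤ σ') :
    |smoothStep R y h σ - smoothStep R y' h' σ'| ≤
      R / δ * (|y - y'| + |h - h'| + |σ - σ'|) := by
  have key := norm_setIntegral_le_of_norm_le_const (μ := volume) (s := Icc (-R) R)
    (C := (|y - y'| + |h - h'| + |σ - σ'|) / δ)
    (f := fun v => unitClamp ((y - coalescing h v) / σ) - unitClamp ((y' - coalescing h' v) / σ'))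
    (by simp) (fun v _ => by
      refine (abs_unitClamp_div_sub_div_le_add _ _ (hδ.trans_le hσ) (hδ.trans_le hσ')).trans ?_
      have := abs_sub_coalescing_sub_le y h y' h' v
      gcongr)
  rw [Real.norm_eq_abs, measureReal_def, Real.volume_Icc, ENNReal.toReal_ofReal (by linarith)] at key
  rw [smoothStep_sub, abs_mul, abs_of_pos (by norm_num)]
  calc _ ≤ 1 / 2 * ((|y - y'| + |h - h'| + |σ - σ'|) / δ * (R - -R)) := by gcongr
    _ = _ := by ring

/-- Scale-invariant local Lipschitz estimate for the smoothed staircases. -/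
lemma abs_smoothStep_sub_le_of_close (R : ℝ) {y h σ y' h' σ' : ℝ} (hσ : 0 < σ) (hσ' : 0 < σ')
    (hh : 0 ≤ h) (hclose : |y - y'| + |h - h'| + |σ - σ'| ≤ σ) :
    |smoothStep R y h σ - smoothStep R y' h' σ'| ≤
      (h / σ + 2) * (|y - y'| + |h - h'| + |σ - σ'|) := by
  set Δ := |y - y'| + |h - h'| + |σ - σ'| with hΔ
  set g : ℝ → ℝ := fun v =>
    unitClamp ((y - coalescing h v) / σ) - unitClamp ((y' - coalescing h' v) / σ') with hg
  -- Jumps move points by at most `h`, so for `|y - v| > h + 2σ` the jump is more than `2σ` away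
  -- from `y` and a change of total size at most `σ` cannot reach its ramp. Only an interval of
  -- length `2(h + 2σ)` contributes, which removes `R` from the constant.
  have hzero : ∀ v ∈ Icc (-R) R \ (Icc (-R) R ∩ Icc (y - (h + 2 * σ)) (y + (h + 2 * σ))),
      g v = 0 := by
    intro v hv
    have hv' : h + 2 * σ < |y - v| := by
      by_contra hcon
      refine hv.2 ⟨hv.1, ?_⟩
      have := abs_le.1 (not_lt.1 hcon)
      constructor <;> linarith
    refine sub_eq_zero.2 (unitClamp_div_eq_of_abs_sub_le hσ hσ' ?_)
    have h1 := abs_sub_coalescing_sub_le y h y' h' v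
    have h2 := abs_coalescing_sub_self_le h v
    rw [abs_of_nonneg hh] at h2
    have h3 : |y - v| ≤ |y - coalescing h v| + |coalescing h v - v| := abs_sub_le _ _ _
    linarith
  have hint : ∫ v in Icc (-R) R, g v =
      ∫ v in Icc (-R) R ∩ Icc (y - (h + 2 * σ)) (y + (h + 2 * σ)), g v :=
    setIntegral_eq_of_subset_of_forall_sdiff_eq_zero measurableSet_Icc inter_subset_left hzero
  have hvol : volume.real (Icc (-R) R ∩ Icc (y - (h + 2 * σ)) (y + (h + 2 * σ))) ≤
      2 * (h + 2 * σ) := by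
    refine (measureReal_mono inter_subset_right (by simp)).trans ?_
    rw [measureReal_def, Real.volume_Icc, ENNReal.toReal_ofReal (by linarith)]
    linarith
  have key := norm_setIntegral_le_of_norm_le_const (μ := volume)
    (s := Icc (-R) R ∩ Icc (y - (h + 2 * σ)) (y + (h + 2 * σ))) (C := Δ / σ) (f := g)
    ((measure_mono inter_subset_left).trans_lt (by simp)) (fun v _ => by
      refine (abs_unitClamp_div_sub_div_le_add _ _ hσ hσ').trans ?_
      have := abs_sub_coalescing_sub_le y h y' h' v
      gcongr
      linarith)
  have hΔ0 : 0 ≤ Δ := by positivity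
  rw [smoothStep_sub, hint, abs_mul, abs_of_pos (by norm_num)]
  rw [Real.norm_eq_abs] at key
  calc _ ≤ 1 / 2 * (Δ / σ * (2 * (h + 2 * σ))) := by
        refine mul_le_mul_of_nonneg_left (key.trans ?_) (by norm_num)
        gcongr
    _ = _ := by field_simp

/-- Away from every ramp the staircase is locally constant in all three parameters at once:
position, scale and window. This is the source of the vanishing rows of the gradient. -/
lemma smoothStep_eq_of_close (R : ℝ) {y h σ y' h' σ' : ℝ} (hσ : 0 < σ) (hσ' : 0 < σ')
    (hclose : |y - y'| + |h - h'| + |σ - σ'| ≤ jumpDist y h - σ) :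
    smoothStep R y h σ = smoothStep R y' h' σ' := by
  rw [smoothStep, smoothStep]
  congr 2 with v
  refine unitClamp_div_eq_of_abs_sub_le hσ hσ' ?_
  have h1 := abs_sub_coalescing_sub_le y h y' h' v
  have h2 := jumpDist_le_abs_sub y h v
  linarith

/-- At scale zero the jumps fill the line uniformly. The ramp is odd about `v = y` and integrates to
zero, so smoothing does not change the value as long as the window stays inside `[-R, R]`. -/
lemma smoothStep_zero {R y σ : ℝ} (hσ : 0 < σ) (hy : |y| + σ ≤ R) : smoothStep R y 0 σ = y := by
  have habs := abs_le.1 (le_refl |y|)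
  have hR : 0 ≤ R := by linarith [abs_nonneg y]
  have hci : ∀ a b : ℝ, IntervalIntegrable (fun v => unitClamp ((y - v) / σ)) volume a b :=
    fun a b => (continuous_unitClamp.comp (by fun_prop)).intervalIntegrable a b
  simp only [smoothStep, coalescing_zero]
  rw [integral_Icc_eq_integral_Ioc, ← intervalIntegral.integral_of_le (by linarith)]
  have hleft : ∫ v in (-R)..(y - σ), unitClamp ((y - v) / σ) = y - σ + R := by
    rw [intervalIntegral.integral_congr (g := fun _ => (1 : ℝ))]
    · simp
    · intro v hv
      rw [uIcc_of_le (by linarith)] at hv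
      exact unitClamp_of_one_le (by rw [one_le_div hσ]; linarith [hv.2])
  have hright : ∫ v in (y + σ)..R, unitClamp ((y - v) / σ) = - (R - (y + σ)) := by
    rw [intervalIntegral.integral_congr (g := fun _ => (-1 : ℝ))]
    · simp
    · intro v hv
      rw [uIcc_of_le (by linarith)] at hv
      exact unitClamp_of_le_neg_one (by rw [div_le_iff₀ hσ]; linarith [hv.1])
  have hmid : ∫ v in (y - σ)..(y + σ), unitClamp ((y - v) / σ) = 0 := by
    rw [intervalIntegral.integral_congr (g := fun v => (y - v) / σ)]
    · simp only [intervalIntegral.integral_div]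
      rw [intervalIntegral.integral_sub (by simp) (by simp)]
      simp [integral_id]; left; ring
    · intro v hv
      rw [uIcc_of_le (by linarith)] at hv
      refine unitClamp_of_mem ?_ ?_
      · rw [le_div_iff₀ hσ]; linarith [hv.2]
      · rw [div_le_iff₀ hσ]; linarith [hv.1]
  rw [← intervalIntegral.integral_add_adjacent_intervals (hci (-R) (y - σ)) (hci _ _),
    ← intervalIntegral.integral_add_adjacent_intervals (hci (y - σ) (y + σ)) (hci _ _), hleft, hmid,
    hright]
  ring

/-! ### Integrability of negative powers of the distance to the jumps -/

lemma lintegral_Icc_abs_rpow_neg_le {a q : ℝ} (ha : 0 < a) (hq1 : q < 1) :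
    ∫⁻ u in Icc (-a) a, ENNReal.ofReal |u| ^ (-q) ≤
      ENNReal.ofReal (2 * (a ^ (1 - q) / (1 - q))) := by
  set f : ℝ → ℝ≥0∞ := (Ioc 0 a).indicator fun u => ENNReal.ofReal u ^ (-q) with hf
  have hfm : Measurable f := by
    refine Measurable.indicator ?_ measurableSet_Ioc
    exact (ENNReal.continuous_rpow_const.measurable).comp ENNReal.measurable_ofReal
  have hfi : ∫⁻ u, f u = ENNReal.ofReal (a ^ (1 - q) / (1 - q)) := by
    rw [lintegral_indicator measurableSet_Ioc]
    have h1 : ∫⁻ u in Ioc 0 a, ENNReal.ofReal u ^ (-q) =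
        ∫⁻ u in Ioc 0 a, ENNReal.ofReal (u ^ (-q)) :=
      setLIntegral_congr_fun measurableSet_Ioc fun u hu => ENNReal.ofReal_rpow_of_pos hu.1
    have h2 : IntegrableOn (fun u : ℝ => u ^ (-q)) (Ioc 0 a) :=
      (intervalIntegrable_iff_integrableOn_Ioc_of_le ha.le).1
        (intervalIntegral.intervalIntegrable_rpow' (by linarith))
    rw [h1, ← ofReal_integral_eq_lintegral_ofReal h2, ← intervalIntegral.integral_of_le ha.le,
      integral_rpow (Or.inl (by linarith)), Real.zero_rpow (by linarith)]
    · congr 2 <;> ring_nf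
    · filter_upwards [ae_restrict_mem measurableSet_Ioc] with u hu using Real.rpow_nonneg hu.1.le _
  calc ∫⁻ u in Icc (-a) a, ENNReal.ofReal |u| ^ (-q)
      ≤ ∫⁻ u, (f u + f (0 - u)) := by
        rw [← lintegral_indicator measurableSet_Icc]
        refine lintegral_mono_ae ?_
        filter_upwards [Measure.ae_ne volume (0 : ℝ)] with u hu0
        by_cases hu : u ∈ Icc (-a) a
        · rw [indicator_of_mem hu]
          rcases lt_or_gt_of_ne hu0 with h | h
          · refine le_trans (le_of_eq ?_) le_add_self
            rw [hf, indicator_of_mem (show (0 - u) ∈ Ioc 0 a from ⟨by linarith, by linarith [hu.1]⟩),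
              abs_of_neg h, zero_sub]
          · refine le_trans (le_of_eq ?_) le_self_add
            rw [hf, indicator_of_mem (show u ∈ Ioc 0 a from ⟨h, hu.2⟩), abs_of_pos h]
        · rw [indicator_of_notMem hu]; exact zero_le
    _ = _ := by
        rw [lintegral_add_left hfm, lintegral_sub_left_eq_self f 0, hfi, ← two_mul,
          ENNReal.ofReal_mul zero_le_two, ENNReal.ofReal_ofNat]

/-- The nearest jump is the image of a set of `v` of measure at least `h / 2`, so a supremum over
jumps is dominated by an integral over `v`, to which Tonelli applies. -/
lemma ofReal_jumpDist_rpow_neg_mul_le {h : ℝ} (hh : 0 < h) (q y : ℝ) :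
    ENNReal.ofReal (jumpDist y h) ^ (-q) * ENNReal.ofReal (h / 2) ≤
      ∫⁻ v, (Icc (-(2 * h)) (2 * h)).indicator (fun u => ENNReal.ofReal |u| ^ (-q))
        (y - coalescing h v) := by
  set F : ℝ → ℝ≥0∞ := (Icc (-(2 * h)) (2 * h)).indicator (fun u => ENNReal.ofReal |u| ^ (-q))
  -- The infimum defining `jumpDist` is not known to be attained. The desired inequality is
  -- therefore put into a closed set containing all the distances, hence also their infimum; the
  -- extra ray `Ici (2 * h)` is excluded at the end by `jumpDist_le`.
  set S : Set ℝ := Ici (2 * h) ∪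
    {t | ENNReal.ofReal t ^ (-q) * ENNReal.ofReal (h / 2) ≤ ∫⁻ v, F (y - coalescing h v)} with hS
  have hclosed : IsClosed S := by
    refine isClosed_Ici.union (isClosed_le ?_ continuous_const)
    exact (ENNReal.continuous_mul_const ENNReal.ofReal_ne_top).comp
      (ENNReal.continuous_rpow_const.comp ENNReal.continuous_ofReal)
  have hsub : range (fun v => |y - coalescing h v|) ⊆ S := by
    rintro _ ⟨v, rfl⟩
    rcases le_or_gt (2 * h) |y - coalescing h v| with hv | hv
    · exact Or.inl hv
    right
    have hF : F (y - coalescing h v) = ENNReal.ofReal |y - coalescing h v| ^ (-q) :=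
      indicator_of_mem (show _ ∈ Icc _ _ from abs_le.1 hv.le) _
    have hms : MeasurableSet {u | coalescing h u = coalescing h v} :=
      measurableSet_eq_fun (measurable_coalescing h) measurable_const
    calc _ ≤ F (y - coalescing h v) * volume {u | coalescing h u = coalescing h v} := by
          rw [hF]; exact mul_le_mul_right (le_volume_fiber_coalescing hh v) _
      _ = ∫⁻ u in {u | coalescing h u = coalescing h v}, F (y - coalescing h u) := by
          rw [← setLIntegral_const]
          refine setLIntegral_congr_fun hms fun u hu => ?_
          simp only [show coalescing h u = coalescing h v from hu]
      _ ≤ _ := setLIntegral_le_lintegral _ _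
  have hmem : jumpDist y h ∈ S :=
    closure_minimal hsub hclosed (csInf_mem_closure (range_nonempty _) (bddBelow_jumpDist y h))
  rcases hmem with hmem | hmem
  · have := jumpDist_le y h
    rw [abs_of_pos hh] at this
    exact absurd (mem_Ici.1 hmem) (by linarith)
  · exact hmem

/-- The mean over a shift in `[0, ρ]` is bounded independently of `h`: there are of order `ρ / h`
jumps in reach, and each contributes a multiple of `h ^ q * h ^ (1 - q) = h`, finite because `q <
1`. -/
lemma lintegral_div_jumpDist_rpow_le {h ρ q : ℝ} (hh : 0 < h) (hhρ : h ≤ ρ) (hq0 : 0 < q)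
    (hq1 : q < 1) (y : ℝ) :
    ∫⁻ θ in Icc 0 ρ, (ENNReal.ofReal h / ENNReal.ofReal (jumpDist (y - θ) h)) ^ q ≤
      ENNReal.ofReal (64 / (1 - q) * ρ) := by
  have hρ : 0 < ρ := hh.trans_le hhρ
  set F : ℝ → ℝ≥0∞ := (Icc (-(2 * h)) (2 * h)).indicator (fun u => ENNReal.ofReal |u| ^ (-q)) with hF
  have hFm : Measurable F := by
    refine Measurable.indicator ?_ measurableSet_Icc
    exact ENNReal.continuous_rpow_const.measurable.comp
      (ENNReal.measurable_ofReal.comp measurable_norm)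
  have hFi : ∫⁻ u, F u ≤ ENNReal.ofReal (2 * ((2 * h) ^ (1 - q) / (1 - q))) := by
    rw [lintegral_indicator measurableSet_Icc]
    exact lintegral_Icc_abs_rpow_neg_le (by linarith) hq1
  have hpt : ∀ θ, (ENNReal.ofReal h / ENNReal.ofReal (jumpDist (y - θ) h)) ^ q ≤
      ENNReal.ofReal (h ^ q * (2 / h)) * ∫⁻ v, F (y - θ - coalescing h v) := by
    intro θ
    have key := ofReal_jumpDist_rpow_neg_mul_le hh q (y - θ)
    rw [ENNReal.div_rpow_of_nonneg _ _ hq0.le, ENNReal.ofReal_rpow_of_pos hh, ENNReal.div_eq_inv_mul,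
      ← ENNReal.rpow_neg, ENNReal.ofReal_mul (by positivity), mul_comm, mul_assoc]
    gcongr
    calc ENNReal.ofReal (jumpDist (y - θ) h) ^ (-q)
        = ENNReal.ofReal (2 / h) *
          (ENNReal.ofReal (jumpDist (y - θ) h) ^ (-q) * ENNReal.ofReal (h / 2)) := by
          rw [mul_left_comm, ← ENNReal.ofReal_mul (by positivity)]
          rw [show 2 / h * (h / 2) = 1 by field_simp, ENNReal.ofReal_one, mul_one]
      _ ≤ _ := by gcongr
  have hmeas : Measurable fun z : ℝ × ℝ => F (y - z.1 - coalescing h z.2) :=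
    hFm.comp ((measurable_const.sub measurable_fst).sub
      ((measurable_coalescing h).comp measurable_snd))
  calc _ ≤ ∫⁻ θ in Icc 0 ρ, ENNReal.ofReal (h ^ q * (2 / h)) *
          ∫⁻ v, F (y - θ - coalescing h v) := lintegral_mono hpt
    _ = ENNReal.ofReal (h ^ q * (2 / h)) *
          ∫⁻ v, ∫⁻ θ in Icc 0 ρ, F (y - θ - coalescing h v) := by
        rw [lintegral_const_mul _ hmeas.lintegral_prod_right', lintegral_lintegral_swap]
        exact hmeas.aemeasurable
    -- The radius `4ρ` collects `2h ≤ 2ρ` from the support of `F`, at most `ρ` from the shift `θ`,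
    -- and at most `h ≤ ρ` from the displacement of `v`.
    _ ≤ ENNReal.ofReal (h ^ q * (2 / h)) * ∫⁻ v in Icc (y - 4 * ρ) (y + 4 * ρ), ∫⁻ u, F u := by
        refine mul_le_mul_right ?_ _
        rw [← lintegral_indicator measurableSet_Icc]
        refine lintegral_mono fun v => ?_
        by_cases hv : v ∈ Icc (y - 4 * ρ) (y + 4 * ρ)
        · rw [indicator_of_mem hv, ← lintegral_sub_left_eq_self F (y - coalescing h v)]
          refine (setLIntegral_le_lintegral _ _).trans (le_of_eq ?_)
          simp only [sub_right_comm]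
        · rw [indicator_of_notMem hv, nonpos_iff_eq_zero]
          refine (setLIntegral_congr_fun measurableSet_Icc (g := fun _ => 0) fun θ hθ => ?_).trans
            (by simp)
          refine indicator_of_notMem (fun hmem => hv ?_) _
          have h1 := abs_le.1 (abs_coalescing_sub_self_le h v)
          rw [abs_of_pos hh] at h1
          have := hmem.1
          have := hmem.2
          have := hθ.1
          have := hθ.2
          constructor <;> linarith
    _ ≤ ENNReal.ofReal (h ^ q * (2 / h)) * (ENNReal.ofReal (2 * ((2 * h) ^ (1 - q) / (1 - q))) *
          ENNReal.ofReal (8 * ρ)) := by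
        rw [setLIntegral_const, Real.volume_Icc]
        gcongr
        linarith
    _ ≤ _ := by
        have h1q : 0 < 1 - q := by linarith
        rw [← ENNReal.ofReal_mul (by positivity), ← ENNReal.ofReal_mul (by positivity)]
        apply ENNReal.ofReal_le_ofReal
        rw [Real.mul_rpow zero_le_two hh.le]
        have h2 : (2 : ℝ) ^ (1 - q) ≤ 2 := by
          simpa using Real.rpow_le_rpow_of_exponent_le one_le_two (by linarith : 1 - q ≤ 1)
        have h3 : h ^ q * h ^ (1 - q) = h := by
          rw [← Real.rpow_add hh]; simp
        calc h ^ q * (2 / h) * (2 * (2 ^ (1 - q) * h ^ (1 - q) / (1 - q)) * (8 * ρ))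
            = (h ^ q * h ^ (1 - q)) / h * (32 * 2 ^ (1 - q) / (1 - q) * ρ) := by ring
          _ ≤ 1 * (32 * 2 / (1 - q) * ρ) := by
              rw [h3, div_self hh.ne']
              gcongr
          _ = _ := by ring

/-! ### Averaging over translations -/

/-- The second smallest entry of a finite family (with multiplicity). -/
noncomputable def secondMin {n : ℕ} (d : Fin n → ℝ) : ℝ :=
  ⨅ k : {k : Fin n × Fin n // k.1 ≠ k.2}, max (d k.1.1) (d k.1.2)

lemma nonempty_pairs {n : ℕ} (hn : 2 ≤ n) : Nonempty {k : Fin n × Fin n // k.1 ≠ k.2} :=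
  ⟨⟨(⟨0, by omega⟩, ⟨1, by omega⟩), by simp⟩⟩

lemma exists_secondMin_eq {n : ℕ} (hn : 2 ≤ n) (d : Fin n → ℝ) :
    ∃ i j : Fin n, i ≠ j ∧ secondMin d = max (d i) (d j) := by
  have := nonempty_pairs hn
  obtain ⟨k, hk⟩ := exists_eq_ciInf_of_finite
    (f := fun k : {k : Fin n × Fin n // k.1 ≠ k.2} => max (d k.1.1) (d k.1.2))
  exact ⟨k.1.1, k.1.2, k.2, hk.symm⟩

lemma exists_forall_ne_secondMin_le {n : ℕ} (hn : 2 ≤ n) (d : Fin n → ℝ) :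
    ∃ i₀ : Fin n, ∀ i, i ≠ i₀ → secondMin d ≤ d i := by
  have : Nonempty (Fin n) := ⟨⟨0, by omega⟩⟩
  obtain ⟨i₀, hi₀⟩ := Finite.exists_min d
  refine ⟨i₀, fun i hi => ?_⟩
  have := ciInf_le (Set.finite_range
    fun k : {k : Fin n × Fin n // k.1 ≠ k.2} => max (d k.1.1) (d k.1.2)).bddBelow ⟨(i, i₀), hi⟩
  simpa [secondMin, max_eq_left (hi₀ i)] using this

lemma abs_secondMin_sub_le {n : ℕ} (hn : 2 ≤ n) {d d' : Fin n → ℝ} {C : ℝ}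
    (h : ∀ i, |d i - d' i| ≤ C) : |secondMin d - secondMin d'| ≤ C := by
  have := nonempty_pairs hn
  exact abs_ciInf_sub_ciInf_le (Set.finite_range _).bddBelow (Set.finite_range _).bddBelow
    fun k => (abs_max_sub_max_le_max _ _ _ _).trans (max_le (h _) (h _))

/-- The second smallest distance of the coordinates of `x`, shifted by `θ`, to the jumps at
scale `h`. -/
noncomputable def jumpGap {n : ℕ} (x θ : Fin n → ℝ) (h : ℝ) : ℝ :=
  secondMin fun i => jumpDist (x i - θ i) h

lemma abs_jumpGap_sub_le {n : ℕ} (hn : 2 ≤ n) {x θ x' θ' : Fin n → ℝ} {h h' C : ℝ}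
    (hC : ∀ i, |x i - θ i - (x' i - θ' i)| ≤ C) :
    |jumpGap x θ h - jumpGap x' θ' h'| ≤ C + |h - h'| :=
  abs_secondMin_sub_le hn fun i =>
    (abs_jumpDist_sub_le _ _ _ _).trans (add_le_add (hC i) le_rfl)

lemma jumpGap_nonneg {n : ℕ} (hn : 2 ≤ n) (x θ : Fin n → ℝ) (h : ℝ) : 0 ≤ jumpGap x θ h := by
  obtain ⟨i, j, -, hij⟩ := exists_secondMin_eq hn fun i => jumpDist (x i - θ i) h
  rw [jumpGap, hij]
  exact le_max_of_le_left (jumpDist_nonneg _ _)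

lemma continuous_jumpGap {n : ℕ} (hn : 2 ≤ n) :
    Continuous fun z : (Fin n → ℝ) × (Fin n → ℝ) × ℝ => jumpGap z.1 z.2.1 z.2.2 := by
  refine (LipschitzWith.of_dist_le_mul (K := 3) fun z w => ?_).continuous
  rw [Real.dist_eq]
  have h1 : ∀ i, |z.1 i - w.1 i| ≤ dist z w := fun i =>
    (dist_le_pi_dist z.1 w.1 i).trans (le_max_left _ _)
  have h2 : ∀ i, |z.2.1 i - w.2.1 i| ≤ dist z w := fun i =>
    (dist_le_pi_dist z.2.1 w.2.1 i).trans ((le_max_left _ _).trans (le_max_right _ _))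
  have h3 : |z.2.2 - w.2.2| ≤ dist z w := (le_max_right _ _).trans (le_max_right _ _)
  refine (abs_jumpGap_sub_le hn (C := 2 * dist z w) fun i => ?_).trans ?_
  · rw [sub_sub_sub_comm]
    exact (abs_sub _ _).trans (by linarith [h1 i, h2 i])
  · push_cast; linarith

/-- The gap is the larger of two distances with distinct indices, so a power `2q` of its inverse
splits into two powers `q`, one for each coordinate. This doubling of the admissible exponent is
where `p < 2` comes from. -/
lemma div_jumpGap_rpow_le {n : ℕ} (hn : 2 ≤ n) (x θ : Fin n → ℝ) (h : ℝ) {q : ℝ} (hq : 0 < q) :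
    (ENNReal.ofReal h / ENNReal.ofReal (jumpGap x θ h)) ^ (2 * q) ≤
      ∑ k : {k : Fin n × Fin n // k.1 ≠ k.2},
        (ENNReal.ofReal h / ENNReal.ofReal (jumpDist (x k.1.1 - θ k.1.1) h)) ^ q *
        (ENNReal.ofReal h / ENNReal.ofReal (jumpDist (x k.1.2 - θ k.1.2) h)) ^ q := by
  obtain ⟨i, j, hne, hij⟩ := exists_secondMin_eq hn fun i => jumpDist (x i - θ i) h
  refine le_trans ?_ (Finset.single_le_sum (fun _ _ => zero_le)
    (Finset.mem_univ (⟨(i, j), hne⟩ : {k : Fin n × Fin n // k.1 ≠ k.2})))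
  rw [two_mul, ENNReal.rpow_add_of_nonneg _ _ hq.le hq.le, jumpGap, hij]
  gcongr
  · exact le_max_left _ _
  · exact le_max_right _ _

lemma lintegral_pi_mul_eval {n : ℕ} (ν : Measure ℝ) [IsProbabilityMeasure ν] {i j : Fin n}
    (hij : i ≠ j) {a b : ℝ → ℝ≥0∞} (ha : Measurable a) (hb : Measurable b) :
    ∫⁻ θ, a (θ i) * b (θ j) ∂(Measure.pi fun _ : Fin n => ν) =
      (∫⁻ t, a t ∂ν) * ∫⁻ t, b t ∂ν := by
  have hind : ProbabilityTheory.iIndepFun (fun (i : Fin n) (w : Fin n → ℝ) => w i)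
      (Measure.pi fun _ : Fin n => ν) :=
    ProbabilityTheory.iIndepFun_pi (X := fun _ t => t) fun _ => aemeasurable_id
  rw [ProbabilityTheory.lintegral_mul_eq_lintegral_mul_lintegral_of_indepFun''
    (f := fun θ : Fin n → ℝ => a (θ i)) (g := fun θ : Fin n → ℝ => b (θ j))
    (ha.comp (measurable_pi_apply i)).aemeasurable (hb.comp (measurable_pi_apply j)).aemeasurable
    ((hind.indepFun hij).comp ha hb)]
  congr 1
  · exact (measurePreserving_eval (fun _ : Fin n => ν) i).lintegral_comp ha
  · exact (measurePreserving_eval (fun _ : Fin n => ν) j).lintegral_comp hb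

/-- Shifts of different coordinates are independent, so the expectation of each product factors into
two one-dimensional means that are finite for `q < 1`. There are at most `n ^ 2` pairs. -/
lemma lintegral_div_jumpGap_rpow_le {n : ℕ} (hn : 2 ≤ n) {h ρ q : ℝ} (hh : 0 < h) (hhρ : h ≤ ρ)
    (hq0 : 0 < q) (hq1 : q < 1) (x : Fin n → ℝ) :
    ∫⁻ θ, (ENNReal.ofReal h / ENNReal.ofReal (jumpGap x θ h)) ^ (2 * q)
      ∂(Measure.pi fun _ : Fin n => ProbabilityTheory.cond volume (Icc 0 ρ)) ≤
      ENNReal.ofReal (n ^ 2 * (64 / (1 - q)) ^ 2) := by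
  have hρ : 0 < ρ := hh.trans_le hhρ
  have hvol : volume (Icc 0 ρ) = ENNReal.ofReal ρ := by simp
  have hprob : IsProbabilityMeasure (ProbabilityTheory.cond volume (Icc 0 ρ)) :=
    ProbabilityTheory.cond_isProbabilityMeasure_of_finite (by simp [hρ]) (by simp)
  have h1q : 0 < 1 - q := by linarith
  have hm : ∀ y : ℝ, Measurable fun θ : ℝ =>
      (ENNReal.ofReal h / ENNReal.ofReal (jumpDist (y - θ) h)) ^ q := fun y =>
    ENNReal.continuous_rpow_const.measurable.comp (measurable_const.div
      (ENNReal.measurable_ofReal.comp (continuous_jumpDist.comp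
        (by fun_prop : Continuous fun θ : ℝ => (y - θ, h))).measurable))
  have h1 : ∀ y, ∫⁻ θ, (ENNReal.ofReal h / ENNReal.ofReal (jumpDist (y - θ) h)) ^ q
      ∂(ProbabilityTheory.cond volume (Icc 0 ρ)) ≤ ENNReal.ofReal (64 / (1 - q)) := by
    intro y
    rw [ProbabilityTheory.cond, lintegral_smul_measure, hvol, smul_eq_mul]
    calc _ ≤ (ENNReal.ofReal ρ)⁻¹ * ENNReal.ofReal (64 / (1 - q) * ρ) := by
          gcongr; exact lintegral_div_jumpDist_rpow_le hh hhρ hq0 hq1 y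
      _ = _ := by
          rw [ENNReal.ofReal_mul (by positivity), mul_left_comm, ENNReal.inv_mul_cancel
            (by simpa using hρ) ENNReal.ofReal_ne_top, mul_one]
  have hcard : Fintype.card {k : Fin n × Fin n // k.1 ≠ k.2} ≤ n ^ 2 :=
    (Fintype.card_subtype_le _).trans (by simp [sq])
  calc _ ≤ ∫⁻ θ, ∑ k : {k : Fin n × Fin n // k.1 ≠ k.2},
        (ENNReal.ofReal h / ENNReal.ofReal (jumpDist (x k.1.1 - θ k.1.1) h)) ^ q *
        (ENNReal.ofReal h / ENNReal.ofReal (jumpDist (x k.1.2 - θ k.1.2) h)) ^ q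
        ∂(Measure.pi fun _ : Fin n => ProbabilityTheory.cond volume (Icc 0 ρ)) :=
        lintegral_mono fun θ => div_jumpGap_rpow_le hn x θ h hq0
    _ = ∑ k : {k : Fin n × Fin n // k.1 ≠ k.2}, ∫⁻ θ,
        (ENNReal.ofReal h / ENNReal.ofReal (jumpDist (x k.1.1 - θ k.1.1) h)) ^ q *
        (ENNReal.ofReal h / ENNReal.ofReal (jumpDist (x k.1.2 - θ k.1.2) h)) ^ q
        ∂(Measure.pi fun _ : Fin n => ProbabilityTheory.cond volume (Icc 0 ρ)) :=
        lintegral_finsetSum _ fun k _ =>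
          ((hm _).comp (measurable_pi_apply _)).mul ((hm _).comp (measurable_pi_apply _))
    _ ≤ ∑ _k : {k : Fin n × Fin n // k.1 ≠ k.2}, ENNReal.ofReal (64 / (1 - q)) ^ 2 := by
        refine Finset.sum_le_sum fun k _ => ?_
        rw [lintegral_pi_mul_eval _ k.2 (hm _) (hm _), sq]
        exact mul_le_mul' (h1 _) (h1 _)
    _ ≤ _ := by
        rw [Finset.sum_const, nsmul_eq_mul, Finset.card_univ, ENNReal.ofReal_mul (by positivity),
          ENNReal.ofReal_pow (by positivity)]
        gcongr
        · rw [ENNReal.ofReal_natCast]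
          exact_mod_cast hcard
        · rw [ENNReal.ofReal_pow (by positivity)]

/-- Some translation has controlled singular set: averaged form of the codimension two
integrability of `1 / jumpGap`. -/
lemma exists_lintegral_div_jumpGap_rpow_le {n : ℕ} (hn : 2 ≤ n) {ρ q : ℝ} (hρ : 0 < ρ)
    (hq0 : 0 < q) (hq1 : q < 1) {B : Set (EuclideanSpace ℝ (Fin n))} (hB : MeasurableSet B)
    {h : EuclideanSpace ℝ (Fin n) → ℝ} (hc : Continuous h)
    (hh : ∀ x ∈ B, 0 < h x ∧ h x ≤ ρ) :
    ∃ θ : Fin n → ℝ, ∫⁻ x in B,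
      (ENNReal.ofReal (h x) / ENNReal.ofReal (jumpGap x.ofLp θ (h x))) ^ (2 * q) ≤
      ENNReal.ofReal (n ^ 2 * (64 / (1 - q)) ^ 2) * volume B := by
  set μ := Measure.pi fun _ : Fin n => ProbabilityTheory.cond (volume : Measure ℝ) (Icc 0 ρ) with hμ
  have hprob : IsProbabilityMeasure (ProbabilityTheory.cond (volume : Measure ℝ) (Icc 0 ρ)) :=
    ProbabilityTheory.cond_isProbabilityMeasure_of_finite (by simp [hρ]) (by simp)
  have hmeas : Measurable fun z : (Fin n → ℝ) × EuclideanSpace ℝ (Fin n) =>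
      (ENNReal.ofReal (h z.2) / ENNReal.ofReal (jumpGap z.2.ofLp z.1 (h z.2))) ^ (2 * q) := by
    refine ENNReal.continuous_rpow_const.measurable.comp (Measurable.div ?_ ?_)
    · exact (ENNReal.continuous_ofReal.comp (hc.comp continuous_snd)).measurable
    · refine (ENNReal.continuous_ofReal.comp ((continuous_jumpGap hn).comp
        (f := fun z : (Fin n → ℝ) × EuclideanSpace ℝ (Fin n) => (z.2.ofLp, z.1, h z.2)) ?_)).measurable
      fun_prop
  -- Some shift does no worse than the mean. After Tonelli the mean is taken at fixed `x`, where the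
  -- bound is uniform in the scale; hence `h` may vary with `x`.
  obtain ⟨θ, hθ⟩ := exists_le_lintegral (μ := μ)
    (f := fun θ => ∫⁻ x in B,
      (ENNReal.ofReal (h x) / ENNReal.ofReal (jumpGap x.ofLp θ (h x))) ^ (2 * q))
    hmeas.lintegral_prod_right'.aemeasurable
  refine ⟨θ, hθ.trans ?_⟩
  rw [lintegral_lintegral_swap hmeas.aemeasurable, ← setLIntegral_const]
  exact setLIntegral_mono' hB fun x hx =>
    lintegral_div_jumpGap_rpow_le hn (hh x hx).1 (hh x hx).2 hq0 hq1 _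

/-! ### Mollification of Lipschitz maps -/

section Mollification

open Filter Topology Convolution

variable {E F : Type*} [NormedAddCommGroup E] [InnerProductSpace ℝ E] [FiniteDimensional ℝ E]
  [MeasurableSpace E] [BorelSpace E] [NormedAddCommGroup F] [NormedSpace ℝ F]
  [FiniteDimensional ℝ F]

/-- Rademacher's theorem supplies the derivative almost everywhere, and the Lipschitz constant
dominates the difference quotients, so differentiation passes under the integral onto `φ`. -/
lemma LipschitzWith.fderiv_normed_convolution {C : NNReal} {φ : E → F} (hφ : LipschitzWith C φ)
    (b : ContDiffBump (0 : E)) (x v : E) :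
    fderiv ℝ (b.normed volume ⋆[ContinuousLinearMap.lsmul ℝ ℝ, volume] φ) x v =
      (b.normed volume ⋆[ContinuousLinearMap.lsmul ℝ ℝ, volume] fun z => fderiv ℝ φ z v) x := by
  borelize F
  have hsm : ContDiff ℝ 1 (b.normed volume ⋆[ContinuousLinearMap.lsmul ℝ ℝ, volume] φ) :=
    HasCompactSupport.contDiff_convolution_left (n := 1) _ b.hasCompactSupport_normed
      b.contDiff_normed hφ.continuous.locallyIntegrable
  have h1 : HasDerivAt
      (fun t : ℝ => (b.normed volume ⋆[ContinuousLinearMap.lsmul ℝ ℝ, volume] φ) (x + t • v))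
      (fderiv ℝ (b.normed volume ⋆[ContinuousLinearMap.lsmul ℝ ℝ, volume] φ) x v) 0 :=
    ((hsm.differentiable one_ne_zero x).hasFDerivAt.hasLineDerivAt v)
  have hae : ∀ᵐ z : E, DifferentiableAt ℝ φ (x - z) :=
    (Measure.measurePreserving_sub_left volume x).quasiMeasurePreserving.ae hφ.ae_differentiableAt
  have h2 := hasDerivAt_integral_of_dominated_loc_of_lip (μ := (volume : Measure E)) (x₀ := (0 : ℝ))
    (s := univ) (𝕜 := ℝ) (F := fun (t : ℝ) z => b.normed volume z • φ (x + t • v - z))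
    (F' := fun z => b.normed volume z • fderiv ℝ φ (x - z) v)
    (bound := fun z => b.normed volume z * (C * ‖v‖)) univ_mem
    (Eventually.of_forall fun t => ?_) ?_ ?_ ?_ ?_ ?_
  · exact h1.unique h2.2
  · exact (b.continuous_normed.smul (hφ.continuous.comp (by fun_prop))).aestronglyMeasurable
  · refine Continuous.integrable_of_hasCompactSupport
      (b.continuous_normed.smul (hφ.continuous.comp (by fun_prop))) ?_
    exact b.hasCompactSupport_normed.smul_right
  · refine b.continuous_normed.aestronglyMeasurable.smul ?_
    exact ((measurable_fderiv_apply_const ℝ φ v).comp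
      (measurable_const.sub measurable_id)).aestronglyMeasurable
  · refine Eventually.of_forall fun z => LipschitzOnWith.of_dist_le_mul fun s _ t _ => ?_
    rw [dist_eq_norm, ← smul_sub, norm_smul, Real.norm_of_nonneg (b.nonneg_normed z),
      Real.coe_nnabs, abs_of_nonneg (mul_nonneg (b.nonneg_normed z) (by positivity)), mul_assoc]
    refine mul_le_mul_of_nonneg_left ?_ (b.nonneg_normed z)
    rw [← dist_eq_norm]
    refine (hφ.dist_le_mul _ _).trans (le_of_eq ?_)
    rw [dist_eq_norm, sub_sub_sub_cancel_right, add_sub_add_left_eq_sub, ← sub_smul, norm_smul,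
      dist_eq_norm]
    ring
  · exact b.integrable_normed.mul_const _
  · filter_upwards [hae] with z hz
    have h3 : HasDerivAt (fun t : ℝ => φ (x - z + t • v)) (fderiv ℝ φ (x - z) v) 0 :=
      hz.hasFDerivAt.hasLineDerivAt v
    refine (h3.const_smul (b.normed volume z)).congr_of_eventuallyEq (Eventually.of_forall fun t => ?_)
    simp only [Pi.smul_apply]
    congr 2
    abel

lemma tendsto_eLpNorm_zero_of_dominated {α G : Type*} [MeasurableSpace α] {μ : Measure α}
    [NormedAddCommGroup G] {p : ℝ≥0∞} (hp0 : p ≠ 0) (hp : p ≠ ⊤) {f : ℕ → α → G} {g : α → ℝ}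
    (hf : ∀ k, AEStronglyMeasurable (f k) μ) (hg : MemLp g p μ)
    (hfg : ∀ k, ∀ᵐ x ∂μ, ‖f k x‖ ≤ g x)
    (hlim : ∀ᵐ x ∂μ, Tendsto (fun k => f k x) atTop (𝓝 0)) :
    Tendsto (fun k => eLpNorm (f k) p μ) atTop (𝓝 0) := by
  have hp' : 0 < p.toReal := ENNReal.toReal_pos hp0 hp
  simp_rw [eLpNorm_eq_lintegral_rpow_enorm_toReal hp0 hp]
  have key := tendsto_lintegral_of_dominated_convergence' (μ := μ)
    (F := fun k x => ‖f k x‖ₑ ^ p.toReal) (f := fun _ => 0) (fun x => ‖g x‖ₑ ^ p.toReal)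
    (fun k => (hf k).enorm.pow_const _) (fun k => ?_)
    (lintegral_rpow_enorm_lt_top_of_eLpNorm_lt_top hp0 hp hg.2).ne ?_
  · have h1 := (ENNReal.continuous_rpow_const (y := 1 / p.toReal)).tendsto
      (∫⁻ _ : α, (0 : ℝ≥0∞) ∂μ)
    have h2 := h1.comp key
    simpa [ENNReal.zero_rpow_of_pos (inv_pos.2 hp'), Function.comp_def] using h2
  · filter_upwards [hfg k] with x hx
    gcongr
    exact enorm_le_iff_norm_le.2 (hx.trans (le_abs_self _))
  · filter_upwards [hlim] with x hx
    have h1 := (ENNReal.continuous_rpow_const (y := p.toReal)).tendsto (0 : ℝ≥0∞)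
    rw [ENNReal.zero_rpow_of_pos hp'] at h1
    refine h1.comp ?_
    simpa using hx.enorm

/-- Mollification: values converge uniformly and gradients almost everywhere by Lebesgue
differentiation. Both are bounded by the Lipschitz constant, so dominated convergence on the bounded
set `Ω` gives convergence in `L^p`. -/
lemma exists_isTestMap_eLpNorm_lt {n N : ℕ} {p : ℝ≥0∞} (hp0 : p ≠ 0) (hp : p ≠ ⊤)
    {Ω : Set (EuclideanSpace ℝ (Fin n))} (hΩ : IsOpen Ω) (hΩb : Bornology.IsBounded Ω)
    {C : NNReal} {φ : EuclideanSpace ℝ (Fin n) → EuclideanSpace ℝ (Fin N)}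
    (hφ : LipschitzWith C φ) (hc : HasCompactSupport φ) (hsub : tsupport φ ⊆ Ω)
    {ε : ℝ≥0∞} (hε : 0 < ε) :
    ∃ ψ : EuclideanSpace ℝ (Fin n) → EuclideanSpace ℝ (Fin N), IsTestMap Ω ψ ∧
      eLpNorm (φ - ψ) p (volume.restrict Ω) < ε ∧
      ∀ (i : Fin N) (j : Fin n),
        eLpNorm (fun x => jacobian φ x i j - jacobian ψ x i j) p (volume.restrict Ω) < ε := by
  have : IsFiniteMeasure (volume.restrict Ω) := ⟨by simpa using hΩb.measure_lt_top⟩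
  let b : ℕ → ContDiffBump (0 : EuclideanSpace ℝ (Fin n)) := fun k =>
    ⟨1 / (k + 1) / 2, 1 / (k + 1), by positivity, half_lt_self (by positivity)⟩
  set ψ : ℕ → EuclideanSpace ℝ (Fin n) → EuclideanSpace ℝ (Fin N) := fun k =>
    (b k).normed volume ⋆[ContinuousLinearMap.lsmul ℝ ℝ, volume] φ with hψ
  have hrout : Tendsto (fun k => (b k).rOut) atTop (𝓝 0) := tendsto_one_div_add_atTop_nhds_zero_nat
  -- A fixed ratio of the radii keeps the kernels comparable to normalised indicators of balls, as
  -- Lebesgue differentiation requires.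
  have hrin : ∀ᶠ k in atTop, (b k).rOut ≤ 2 * (b k).rIn :=
    Eventually.of_forall fun k => by
      change (1 : ℝ) / (k + 1) ≤ 2 * (1 / (k + 1) / 2)
      linarith
  have hψs : ∀ k, ContDiff ℝ ∞ (ψ k) := fun k =>
    HasCompactSupport.contDiff_convolution_left (n := ⊤) _ (b k).hasCompactSupport_normed
      (b k).contDiff_normed hφ.continuous.locallyIntegrable
  have hψc : ∀ k, HasCompactSupport (ψ k) := fun k =>
    HasCompactSupport.convolution _ (b k).hasCompactSupport_normed hc
  obtain ⟨δ, hδ, hδΩ⟩ := hc.isCompact.exists_cthickening_subset_open hΩ hsub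
  have hψΩ : ∀ᶠ k in atTop, tsupport (ψ k) ⊆ Ω := by
    filter_upwards [hrout.eventually (gt_mem_nhds hδ)] with k hk
    refine (closure_minimal ?_ Metric.isClosed_cthickening).trans hδΩ
    refine (support_convolution_subset _).trans ?_
    rintro _ ⟨u, hu, w, hw, rfl⟩
    rw [(b k).support_normed_eq, mem_ball_zero_iff] at hu
    refine Metric.mem_cthickening_of_dist_le _ w _ _ (subset_tsupport _ hw) ?_
    simpa using (hu.trans hk).le
  have hdist : ∀ k x, dist (ψ k x) (φ x) ≤ C * (b k).rOut := fun k x => by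
    refine ContDiffBump.dist_normed_convolution_le hφ.continuous.aestronglyMeasurable fun y hy => ?_
    exact (hφ.dist_le_mul y x).trans (by gcongr; exact (Metric.mem_ball.1 hy).le)
  have hrout1 : ∀ k, (b k).rOut ≤ 1 := fun k => by
    change (1 : ℝ) / (k + 1) ≤ 1
    rw [div_le_one (by positivity)]; linarith [(Nat.cast_nonneg k : (0 : ℝ) ≤ k)]
  have hlim1 : Tendsto (fun k => eLpNorm (φ - ψ k) p (volume.restrict Ω)) atTop (𝓝 0) := by
    refine tendsto_eLpNorm_zero_of_dominated hp0 hp (g := fun _ => (C : ℝ)) (fun k => ?_)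
      (memLp_const _) (fun k => Eventually.of_forall fun x => ?_) (Eventually.of_forall fun x => ?_)
    · exact (hφ.continuous.sub (hψs k).continuous).aestronglyMeasurable
    · rw [Pi.sub_apply, ← dist_eq_norm, dist_comm]
      exact (hdist k x).trans (mul_le_of_le_one_right C.2 (hrout1 k))
    · rw [tendsto_zero_iff_norm_tendsto_zero]
      refine squeeze_zero (fun _ => norm_nonneg _) (fun k => ?_)
        (by simpa using hrout.const_mul (C : ℝ))
      rw [Pi.sub_apply, ← dist_eq_norm, dist_comm]
      exact hdist k x
  have hnd : ∀ (g : EuclideanSpace ℝ (Fin n) → EuclideanSpace ℝ (Fin N)) (hg : LipschitzWith C g)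
      x (i : Fin N) (j : Fin n), |jacobian g x i j| ≤ C := fun g hg x i j => by
    refine (PiLp.norm_apply_le (fderiv ℝ g x (EuclideanSpace.single j 1)) i).trans ?_
    refine ((fderiv ℝ g x).le_opNorm _).trans ?_
    rw [PiLp.norm_single, norm_one, mul_one]
    exact norm_fderiv_le_of_lipschitz ℝ hg
  have hψL : ∀ k, LipschitzWith C (ψ k) := fun k => by
    refine LipschitzWith.of_dist_le_mul fun x y => ?_
    simp only [hψ, convolution_def]
    have hint : ∀ x, Integrable fun t =>
        ContinuousLinearMap.lsmul ℝ ℝ ((b k).normed volume t) (φ (x - t)) := fun x => by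
      refine Continuous.integrable_of_hasCompactSupport
        ((b k).continuous_normed.smul (hφ.continuous.comp (by fun_prop))) ?_
      exact (b k).hasCompactSupport_normed.smul_right
    rw [dist_eq_norm, ← integral_sub (hint x) (hint y)]
    refine (norm_integral_le_of_norm_le (((b k).integrable_normed (μ := volume)).mul_const
      (C * dist x y)) (Eventually.of_forall fun t => ?_)).trans (le_of_eq ?_)
    · rw [← map_sub, ContinuousLinearMap.lsmul_apply, norm_smul,
        Real.norm_of_nonneg ((b k).nonneg_normed t), ← dist_eq_norm]
      refine mul_le_mul_of_nonneg_left ((hφ.dist_le_mul _ _).trans (by simp)) ((b k).nonneg_normed t)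
    · rw [integral_mul_const, (b k).integral_normed, one_mul]
  have hjm : ∀ (g : EuclideanSpace ℝ (Fin n) → EuclideanSpace ℝ (Fin N)) (i : Fin N) (j : Fin n),
      Measurable fun x => jacobian g x i j := fun g i j =>
    ((EuclideanSpace.proj (𝕜 := ℝ) i).continuous.measurable).comp
      (measurable_fderiv_apply_const ℝ g _)
  have hlim2 : ∀ (i : Fin N) (j : Fin n), Tendsto (fun k => eLpNorm
      (fun x => jacobian φ x i j - jacobian (ψ k) x i j) p (volume.restrict Ω)) atTop (𝓝 0) := by
    intro i j
    refine tendsto_eLpNorm_zero_of_dominated hp0 hp (g := fun _ => (C : ℝ) + C) (fun k => ?_)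
      (memLp_const _) (fun k => Eventually.of_forall fun x => ?_) (ae_restrict_of_ae ?_)
    · exact ((hjm φ i j).sub (hjm (ψ k) i j)).aestronglyMeasurable
    · exact (norm_sub_le _ _).trans (add_le_add (hnd φ hφ x i j) (hnd (ψ k) (hψL k) x i j))
    · have hloc : LocallyIntegrable (fun z => fderiv ℝ φ z (EuclideanSpace.single j 1))
          (volume : Measure (EuclideanSpace ℝ (Fin n))) := by
        refine (locallyIntegrable_const (C : ℝ)).mono
          (measurable_fderiv_apply_const ℝ φ _).aestronglyMeasurable (Eventually.of_forall fun z => ?_)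
        refine ((fderiv ℝ φ z).le_opNorm _).trans ?_
        rw [PiLp.norm_single, norm_one, mul_one]
        exact (norm_fderiv_le_of_lipschitz ℝ hφ).trans (le_abs_self _)
      filter_upwards [ContDiffBump.ae_convolution_tendsto_right_of_locallyIntegrable (φ := b)
        hrout hrin hloc] with x hx
      simp_rw [← hφ.fderiv_normed_convolution] at hx
      have h1 := ((EuclideanSpace.proj (𝕜 := ℝ) i).continuous.tendsto
        _).comp hx
      have h2 := (tendsto_const_nhds (x := jacobian φ x i j)).sub h1
      simpa [jacobian] using h2
  obtain ⟨k, hk1, hk2, hk3⟩ := (hψΩ.and ((hlim1.eventually (gt_mem_nhds hε)).and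
    (eventually_all.2 fun i => eventually_all.2 fun j =>
      (hlim2 i j).eventually (gt_mem_nhds hε)))).exists
  exact ⟨ψ k, ⟨hψs k, hψc k, hk1⟩, hk2, hk3⟩

end Mollification

/-! ### Membership in `W^{1,p}_0` by approximation -/

section Approximation

open Filter Topology

variable {n N : ℕ}

lemma measurable_jacobian_apply
    (g : EuclideanSpace ℝ (Fin n) → EuclideanSpace ℝ (Fin N)) (i : Fin N) (j : Fin n) :
    Measurable fun x => jacobian g x i j :=
  ((EuclideanSpace.proj (𝕜 := ℝ) i).continuous.measurable).comp
    (measurable_fderiv_apply_const ℝ g _)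

lemma IsTestMap.continuous_jacobian_apply {Ω : Set (EuclideanSpace ℝ (Fin n))}
    {ψ : EuclideanSpace ℝ (Fin n) → EuclideanSpace ℝ (Fin N)} (hψ : IsTestMap Ω ψ) (i : Fin N)
    (j : Fin n) : Continuous fun x => jacobian ψ x i j :=
  (EuclideanSpace.proj (𝕜 := ℝ) i).continuous.comp
    ((hψ.smooth.continuous_fderiv (by simp)).clm_apply continuous_const)

lemma IsTestMap.hasCompactSupport_jacobian_apply {Ω : Set (EuclideanSpace ℝ (Fin n))}
    {ψ : EuclideanSpace ℝ (Fin n) → EuclideanSpace ℝ (Fin N)} (hψ : IsTestMap Ω ψ) (i : Fin N)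
    (j : Fin n) : HasCompactSupport fun x => jacobian ψ x i j := by
  refine (hψ.compactSupport.fderiv (𝕜 := ℝ)).mono fun x hx => ?_
  rw [Function.mem_support] at hx ⊢
  contrapose! hx
  simp [jacobian, hx]

lemma IsTestMap.integral_mul_eq {Ω : Set (EuclideanSpace ℝ (Fin n))}
    {ψ : EuclideanSpace ℝ (Fin n) → EuclideanSpace ℝ (Fin N)} (hψ : IsTestMap Ω ψ)
    {η : EuclideanSpace ℝ (Fin n) → ℝ} (hη : IsTestMap Ω η) (i : Fin N) (j : Fin n) :
    ∫ x in Ω, ψ x i * fderiv ℝ η x (EuclideanSpace.single j 1) =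
      - ∫ x in Ω, jacobian ψ x i j * η x := by
  have hηout : ∀ x ∉ Ω, η x = 0 := fun x hx => image_eq_zero_of_notMem_tsupport
    fun h => hx (hη.tsupport_subset h)
  have hψout : ∀ x ∉ Ω, ψ x = 0 := fun x hx => image_eq_zero_of_notMem_tsupport
    fun h => hx (hψ.tsupport_subset h)
  rw [setIntegral_eq_integral_of_forall_compl_eq_zero fun x hx => by simp [hψout x hx],
    setIntegral_eq_integral_of_forall_compl_eq_zero fun x hx => by simp [hηout x hx]]
  have hψi : ContDiff ℝ ∞ fun x => ψ x i :=
    (EuclideanSpace.proj (𝕜 := ℝ) i).contDiff.comp hψ.smooth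
  have hjac : ∀ x, jacobian ψ x i j = fderiv ℝ (fun x => ψ x i) x (EuclideanSpace.single j 1) := by
    intro x
    have h1 : HasFDerivAt (fun x => ψ x i)
        ((EuclideanSpace.proj (𝕜 := ℝ) i).comp (fderiv ℝ ψ x)) x :=
      (EuclideanSpace.proj (𝕜 := ℝ) i).hasFDerivAt.comp x
        (hψ.smooth.differentiable (by simp) x).hasFDerivAt
    rw [h1.fderiv]; rfl
  have hηd : Continuous fun x => fderiv ℝ η x (EuclideanSpace.single j 1) :=
    (hη.smooth.continuous_fderiv (by simp)).clm_apply continuous_const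
  have hcη : ∀ g : EuclideanSpace ℝ (Fin n) → ℝ, Continuous g → Integrable fun x => g x * η x :=
    fun g hg => (hg.mul hη.smooth.continuous).integrable_of_hasCompactSupport
      hη.compactSupport.mul_left
  simp_rw [hjac]
  refine integral_mul_fderiv_eq_neg_fderiv_mul_of_integrable ?_ ?_ ?_ ?_ ?_
  · refine hcη _ ?_
    simp_rw [← hjac]
    exact hψ.continuous_jacobian_apply i j
  · refine (hψi.continuous.mul hηd).integrable_of_hasCompactSupport
      (HasCompactSupport.mul_right ?_)
    refine hψ.compactSupport.mono fun x hx => ?_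
    rw [Function.mem_support] at hx ⊢
    contrapose! hx
    simp [hx]
  · exact hcη _ hψi.continuous
  · exact fun x _ => hψi.differentiable (by simp) x
  · exact fun x _ => hη.smooth.differentiable (by simp) x

/-- Maps in `L^p` with `L^p` candidate gradient that are limits of test maps. -/
lemma memW1pZero_of_approx {p : ℝ≥0∞} (hp1 : 1 ≤ p) {Ω : Set (EuclideanSpace ℝ (Fin n))}
    (hΩb : Bornology.IsBounded Ω)
    {φ : EuclideanSpace ℝ (Fin n) → EuclideanSpace ℝ (Fin N)}
    {G : EuclideanSpace ℝ (Fin n) → Matrix (Fin N) (Fin n) ℝ}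
    (hφ : MemLp φ p (volume.restrict Ω))
    (hG : ∀ i j, MemLp (fun x => G x i j) p (volume.restrict Ω))
    (happ : ∀ ε : ℝ≥0∞, 0 < ε →
      ∃ ψ : EuclideanSpace ℝ (Fin n) → EuclideanSpace ℝ (Fin N), IsTestMap Ω ψ ∧
        eLpNorm (φ - ψ) p (volume.restrict Ω) < ε ∧
        ∀ (i : Fin N) (j : Fin n),
          eLpNorm (fun x => G x i j - jacobian ψ x i j) p (volume.restrict Ω) < ε) :
    MemW1pZero p Ω φ G := by
  have : IsFiniteMeasure (volume.restrict Ω) := ⟨by simpa using hΩb.measure_lt_top⟩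
  refine ⟨⟨hφ, hG, ⟨?_, fun i j => ?_, fun η hη i j => ?_⟩⟩, happ⟩
  · exact (show IntegrableOn φ Ω volume from hφ.integrable hp1).locallyIntegrableOn
  · exact (show IntegrableOn (fun x => G x i j) Ω volume from (hG i j).integrable hp1).locallyIntegrableOn
  set μ := volume.restrict Ω with hμ
  set dη : EuclideanSpace ℝ (Fin n) → ℝ := fun x => fderiv ℝ η x (EuclideanSpace.single j 1)
    with hdη
  have hdηc : Continuous dη := (hη.smooth.continuous_fderiv (by simp)).clm_apply continuous_const
  obtain ⟨M₁, hM₁⟩ := hη.compactSupport.exists_bound_of_continuous hη.smooth.continuous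
  obtain ⟨M₂, hM₂⟩ := (hη.compactSupport.fderiv_apply (𝕜 := ℝ)
    (EuclideanSpace.single j 1)).exists_bound_of_continuous hdηc
  have hφi : Integrable (fun x => φ x i) μ :=
    (EuclideanSpace.proj (𝕜 := ℝ) i).integrable_comp (hφ.integrable hp1)
  have hGi : Integrable (fun x => G x i j) μ := (hG i j).integrable hp1
  have hbmul : ∀ g : EuclideanSpace ℝ (Fin n) → ℝ, Integrable g μ →
      Integrable (fun x => g x * dη x) μ ∧ Integrable (fun x => g x * η x) μ := fun g hg =>
    ⟨hg.mul_bdd hdηc.aestronglyMeasurable (Eventually.of_forall hM₂),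
      hg.mul_bdd hη.smooth.continuous.aestronglyMeasurable (Eventually.of_forall hM₁)⟩
  -- The Hölder constant for the inclusion of `L^p` in `L^1` on the finite measure space `Ω`.
  set K : ℝ≥0∞ := μ univ ^ (1 / (1 : ℝ≥0∞).toReal - 1 / p.toReal) with hK
  have hKtop : K ≠ ⊤ := by
    refine ENNReal.rpow_ne_top_of_nonneg ?_ (measure_ne_top _ _)
    rcases eq_or_ne p ⊤ with rfl | hp
    · simp
    · rw [ENNReal.toReal_one, sub_nonneg]
      refine one_div_le_one_div_of_le one_pos ?_
      simpa using ENNReal.toReal_mono hp hp1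
  have hL1 : ∀ g : EuclideanSpace ℝ (Fin n) → ℝ, ∀ ε : NNReal, Integrable g μ →
      eLpNorm g p μ ≤ ε → ∫ x, |g x| ∂μ ≤ ε * K.toReal := by
    intro g ε hg hgε
    have h1 := (eLpNorm_le_eLpNorm_mul_rpow_measure_univ hp1 hg.1).trans
      (mul_le_mul_left hgε K)
    have h2 := integral_norm_eq_lintegral_enorm hg.1
    rw [← eLpNorm_one_eq_lintegral_enorm] at h2
    simp only [Real.norm_eq_abs] at h2
    rw [h2]
    refine (ENNReal.toReal_mono (ENNReal.mul_ne_top ENNReal.coe_ne_top hKtop) h1).trans ?_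
    rw [ENNReal.toReal_mul, ENNReal.coe_toReal]
  have key : ∀ ε : NNReal, 0 < ε →
      |∫ x, φ x i * dη x ∂μ + ∫ x, G x i j * η x ∂μ| ≤ ε * (K.toReal * (|M₂| + |M₁|)) := by
    intro ε hε
    obtain ⟨ψ, hψ, h1, h2⟩ := happ ε (by exact_mod_cast hε)
    have hψi : Integrable (fun x => ψ x i) μ :=
      (EuclideanSpace.proj (𝕜 := ℝ) i).integrable_comp
        (hψ.smooth.continuous.integrable_of_hasCompactSupport hψ.compactSupport).restrict
    have hJi : Integrable (fun x => jacobian ψ x i j) μ :=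
      ((hψ.continuous_jacobian_apply i j).integrable_of_hasCompactSupport
        (hψ.hasCompactSupport_jacobian_apply i j)).restrict
    have hzero := hψ.integral_mul_eq hη i j
    have e1 : ∫ x, φ x i * dη x ∂μ - ∫ x, ψ x i * dη x ∂μ = ∫ x, (φ x i - ψ x i) * dη x ∂μ := by
      rw [← integral_sub (hbmul _ hφi).1 (hbmul _ hψi).1]; simp_rw [sub_mul]
    have e2 : ∫ x, G x i j * η x ∂μ - ∫ x, jacobian ψ x i j * η x ∂μ =
        ∫ x, (G x i j - jacobian ψ x i j) * η x ∂μ := by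
      rw [← integral_sub (hbmul _ hGi).2 (hbmul _ hJi).2]; simp_rw [sub_mul]
    have b1 : |∫ x, (φ x i - ψ x i) * dη x ∂μ| ≤ ε * K.toReal * |M₂| := by
      rw [← Real.norm_eq_abs]
      refine (norm_integral_le_of_norm_le ((hφi.sub hψi).abs.mul_const |M₂|)
        (Eventually.of_forall fun x => ?_)).trans ?_
      · rw [norm_mul, Real.norm_eq_abs]
        exact mul_le_mul_of_nonneg_left ((hM₂ x).trans (le_abs_self _)) (abs_nonneg _)
      · rw [integral_mul_const]
        refine mul_le_mul_of_nonneg_right (hL1 _ ε (hφi.sub hψi) ?_) (abs_nonneg _)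
        refine (eLpNorm_mono fun x => ?_).trans h1.le
        exact PiLp.norm_apply_le (φ x - ψ x) i
    have b2 : |∫ x, (G x i j - jacobian ψ x i j) * η x ∂μ| ≤ ε * K.toReal * |M₁| := by
      rw [← Real.norm_eq_abs]
      refine (norm_integral_le_of_norm_le ((hGi.sub hJi).abs.mul_const |M₁|)
        (Eventually.of_forall fun x => ?_)).trans ?_
      · rw [norm_mul, Real.norm_eq_abs]
        exact mul_le_mul_of_nonneg_left ((hM₁ x).trans (le_abs_self _)) (abs_nonneg _)
      · rw [integral_mul_const]
        exact mul_le_mul_of_nonneg_right (hL1 _ ε (hGi.sub hJi) (h2 i j).le) (abs_nonneg _)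
    have : ∫ x, φ x i * dη x ∂μ + ∫ x, G x i j * η x ∂μ =
        ∫ x, (φ x i - ψ x i) * dη x ∂μ + ∫ x, (G x i j - jacobian ψ x i j) * η x ∂μ := by
      rw [← e1, ← e2]
      linarith
    rw [this]
    refine (abs_add_le _ _).trans ((add_le_add b1 b2).trans (le_of_eq ?_))
    ring
  have hfin : |∫ x, φ x i * dη x ∂μ + ∫ x, G x i j * η x ∂μ| ≤ 0 := by
    set c := K.toReal * (|M₂| + |M₁|) with hc
    have hc0 : 0 ≤ c := by positivity
    refine le_of_forall_pos_le_add fun (ε : ℝ) hε => ?_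
    -- The constant `c` may vanish, hence the denominator `c + 1`.
    have hpos : 0 < ε / (c + 1) := div_pos hε (by linarith)
    have h1 := key (ε / (c + 1)).toNNReal (Real.toNNReal_pos.2 hpos)
    refine h1.trans ?_
    rw [zero_add, Real.coe_toNNReal _ hpos.le, div_mul_eq_mul_div, div_le_iff₀ (by linarith)]
    nlinarith
  have := abs_nonpos_iff.1 hfin
  linarith

lemma IsTestMap.memW1pZero {p : ℝ≥0∞} (hp1 : 1 ≤ p) {Ω : Set (EuclideanSpace ℝ (Fin n))}
    (hΩb : Bornology.IsBounded Ω)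
    {ψ : EuclideanSpace ℝ (Fin n) → EuclideanSpace ℝ (Fin N)} (hψ : IsTestMap Ω ψ) :
    MemW1pZero p Ω ψ (jacobian ψ) := by
  refine memW1pZero_of_approx hp1 hΩb ?_ (fun i j => ?_) fun ε hε => ⟨ψ, hψ, ?_, fun i j => ?_⟩
  · exact (hψ.smooth.continuous.memLp_of_hasCompactSupport hψ.compactSupport).restrict _
  · exact ((hψ.continuous_jacobian_apply i j).memLp_of_hasCompactSupport
      (hψ.hasCompactSupport_jacobian_apply i j)).restrict _
  · simpa using hε
  · simpa using hε

/-- A map that is eventually equal, together with its gradient, to the terms of a sequence of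
Lipschitz maps with a common compact support and dominated gradients. -/
lemma memW1pZero_of_lipschitz_approx {p : ℝ≥0∞} (hp1 : 1 ≤ p) (hp : p ≠ ⊤)
    {Ω : Set (EuclideanSpace ℝ (Fin n))} (hΩ : IsOpen Ω) (hΩb : Bornology.IsBounded Ω)
    {φ : EuclideanSpace ℝ (Fin n) → EuclideanSpace ℝ (Fin N)}
    {φs : ℕ → EuclideanSpace ℝ (Fin n) → EuclideanSpace ℝ (Fin N)} {C : ℕ → NNReal}
    (hlip : ∀ k, LipschitzWith (C k) (φs k)) {S : Set (EuclideanSpace ℝ (Fin n))}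
    (hS : IsCompact S) (hSΩ : S ⊆ Ω) (hsupp : ∀ k, ∀ x ∉ S, φs k x = 0)
    {M : ℝ} (hM : ∀ k x, ‖φs k x‖ ≤ M) {g : EuclideanSpace ℝ (Fin n) → ℝ}
    (hg : MemLp g p (volume.restrict Ω))
    (hgrad : ∀ k, ∀ᵐ x ∂(volume.restrict Ω), ∀ i j, |jacobian (φs k) x i j| ≤ g x)
    (hlim : ∀ᵐ x ∂(volume.restrict Ω), ∀ᶠ k in atTop,
      φs k x = φ x ∧ jacobian (φs k) x = jacobian φ x) :
    MemW1pZero p Ω φ (jacobian φ) := by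
  have : IsFiniteMeasure (volume.restrict Ω) := ⟨by simpa using hΩb.measure_lt_top⟩
  have hp0 : p ≠ 0 := (zero_lt_one.trans_le hp1).ne'
  set μ := volume.restrict Ω with hμ
  have hφm : AEStronglyMeasurable φ μ := by
    refine aestronglyMeasurable_of_tendsto_ae atTop
      (fun k => (hlip k).continuous.aestronglyMeasurable) ?_
    filter_upwards [hlim] with x hx
    exact tendsto_const_nhds.congr' (hx.mono fun k hk => hk.1.symm)
  have hφM : ∀ᵐ x ∂μ, ‖φ x‖ ≤ M := by
    filter_upwards [hlim] with x hx
    obtain ⟨k, hk⟩ := hx.exists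
    exact hk.1 ▸ hM k x
  have hGg : ∀ᵐ x ∂μ, ∀ i j, |jacobian φ x i j| ≤ g x := by
    filter_upwards [hlim, ae_all_iff.2 hgrad] with x hx hx2
    obtain ⟨k, hk⟩ := hx.exists
    exact hk.2 ▸ hx2 k
  refine memW1pZero_of_approx hp1 hΩb (MemLp.of_bound hφm M hφM) (fun i j => ?_) fun ε hε => ?_
  · refine hg.mono' (measurable_jacobian_apply φ i j).aestronglyMeasurable ?_
    filter_upwards [hGg] with x hx using hx i j
  have hlim1 : Tendsto (fun k => eLpNorm (φ - φs k) p μ) atTop (𝓝 0) := by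
    refine tendsto_eLpNorm_zero_of_dominated hp0 hp (g := fun _ => M + M)
      (fun k => hφm.sub (hlip k).continuous.aestronglyMeasurable) (memLp_const _) (fun k => ?_) ?_
    · filter_upwards [hφM] with x hx
      exact (norm_sub_le _ _).trans (add_le_add hx (hM k x))
    · filter_upwards [hlim] with x hx
      refine tendsto_const_nhds.congr' (hx.mono fun k hk => ?_)
      simp [hk.1]
  have hlim2 : ∀ i j, Tendsto (fun k =>
      eLpNorm (fun x => jacobian φ x i j - jacobian (φs k) x i j) p μ) atTop (𝓝 0) := by
    intro i j
    refine tendsto_eLpNorm_zero_of_dominated hp0 hp (g := fun x => g x + g x)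
      (fun k => ((measurable_jacobian_apply φ i j).sub
        (measurable_jacobian_apply (φs k) i j)).aestronglyMeasurable) (hg.add hg) (fun k => ?_) ?_
    · filter_upwards [hGg, hgrad k] with x hx hx2
      exact (norm_sub_le _ _).trans (add_le_add (hx i j) (hx2 i j))
    · filter_upwards [hlim] with x hx
      refine tendsto_const_nhds.congr' (hx.mono fun k hk => ?_)
      simp [hk.2]
  have hε2 : 0 < ε / 2 := ENNReal.half_pos hε.ne'
  obtain ⟨k, hk1, hk2⟩ := ((hlim1.eventually (gt_mem_nhds hε2)).and
    (eventually_all.2 fun i => eventually_all.2 fun j =>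
      (hlim2 i j).eventually (gt_mem_nhds hε2))).exists
  have hts : tsupport (φs k) ⊆ S := closure_minimal
    (fun x hx => by_contra fun h => hx (hsupp k x h)) hS.isClosed
  obtain ⟨ψ, hψ, h1, h2⟩ := exists_isTestMap_eLpNorm_lt hp0 hp hΩ hΩb (hlip k)
    (hS.of_isClosed_subset (isClosed_tsupport _) hts) (hts.trans hSΩ) hε2
  refine ⟨ψ, hψ, ?_, fun i j => ?_⟩
  · calc eLpNorm (φ - ψ) p μ = eLpNorm ((φ - φs k) + (φs k - ψ)) p μ := by rw [sub_add_sub_cancel]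
      _ ≤ eLpNorm (φ - φs k) p μ + eLpNorm (φs k - ψ) p μ :=
        eLpNorm_add_le (hφm.sub (hlip k).continuous.aestronglyMeasurable)
          ((hlip k).continuous.sub hψ.smooth.continuous).aestronglyMeasurable hp1
      _ < ε / 2 + ε / 2 := ENNReal.add_lt_add hk1 h1
      _ = ε := ENNReal.add_halves ε
  · calc eLpNorm (fun x => jacobian φ x i j - jacobian ψ x i j) p μ
        = eLpNorm ((fun x => jacobian φ x i j - jacobian (φs k) x i j) +
            fun x => jacobian (φs k) x i j - jacobian ψ x i j) p μ := by
          congr 1; ext x; simp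
      _ ≤ _ := eLpNorm_add_le
          ((measurable_jacobian_apply φ i j).sub
            (measurable_jacobian_apply (φs k) i j)).aestronglyMeasurable
          ((measurable_jacobian_apply (φs k) i j).sub
            (measurable_jacobian_apply ψ i j)).aestronglyMeasurable hp1
      _ < ε / 2 + ε / 2 := ENNReal.add_lt_add (hk2 i j) (h2 i j)
      _ = ε := ENNReal.add_halves ε

end Approximation

/-! ### A map with gradient of rank at most one and affine boundary values -/

section Fold

open Filter Topology

variable {n N : ℕ}

/-- The length scale of the folding: the distance to the complement of a ball. -/
noncomputable def foldScale (x₀ : EuclideanSpace ℝ (Fin n)) (ρ : ℝ)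
    (x : EuclideanSpace ℝ (Fin n)) : ℝ := max 0 (ρ - dist x x₀)

/-- The gap between the coordinates of `x` and the jumps at the local scale. -/
noncomputable def foldGap (x₀ : EuclideanSpace ℝ (Fin n)) (ρ : ℝ) (θ : Fin n → ℝ)
    (x : EuclideanSpace ℝ (Fin n)) : ℝ := jumpGap x.ofLp θ (foldScale x₀ ρ x)

/-- The smoothing window. -/
noncomputable def foldWindow (x₀ : EuclideanSpace ℝ (Fin n)) (ρ : ℝ) (θ : Fin n → ℝ) (δ : ℝ)
    (x : EuclideanSpace ℝ (Fin n)) : ℝ := max (foldGap x₀ ρ θ x) δ / 2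

/-- A bound for the coordinates of the points under consideration. -/
noncomputable def foldRadius (x₀ : EuclideanSpace ℝ (Fin n)) (ρ : ℝ) (θ : Fin n → ℝ) : ℝ :=
  ‖x₀‖ + ‖θ‖ + 3 * ρ

/-- The coordinates of the displacement of the folding map. -/
noncomputable def foldCoord (x₀ : EuclideanSpace ℝ (Fin n)) (ρ : ℝ) (θ : Fin n → ℝ) (δ : ℝ)
    (i : Fin n) (x : EuclideanSpace ℝ (Fin n)) : ℝ :=
  smoothStep (foldRadius x₀ ρ θ) (x i - θ i) (foldScale x₀ ρ x) (foldWindow x₀ ρ θ δ x) -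
    smoothStep (foldRadius x₀ ρ θ) (x i - θ i) 0 (foldWindow x₀ ρ θ δ x)

variable {x₀ : EuclideanSpace ℝ (Fin n)} {ρ δ : ℝ} {θ : Fin n → ℝ}

lemma foldScale_nonneg (x : EuclideanSpace ℝ (Fin n)) : 0 ≤ foldScale x₀ ρ x := le_max_left _ _

lemma foldScale_le (hρ : 0 < ρ) (x : EuclideanSpace ℝ (Fin n)) : foldScale x₀ ρ x ≤ ρ :=
  max_le hρ.le (by linarith [dist_nonneg (x := x) (y := x₀)])

lemma foldScale_pos {x : EuclideanSpace ℝ (Fin n)} (hx : x ∈ Metric.ball x₀ ρ) :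
    0 < foldScale x₀ ρ x := lt_max_of_lt_right (sub_pos.2 hx)

lemma foldScale_eq_zero {x : EuclideanSpace ℝ (Fin n)} (hx : x ∉ Metric.ball x₀ ρ) :
    foldScale x₀ ρ x = 0 := max_eq_left (by simpa using hx)

lemma abs_foldScale_sub_le (x x' : EuclideanSpace ℝ (Fin n)) :
    |foldScale x₀ ρ x - foldScale x₀ ρ x'| ≤ dist x x' := by
  refine (abs_max_sub_max_le_max _ _ _ _).trans ?_
  rw [sub_self, abs_zero, sub_sub_sub_cancel_left]
  refine max_le dist_nonneg ?_
  rw [dist_comm x x']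
  exact abs_dist_sub_le x' x x₀

lemma continuous_foldScale : Continuous (foldScale x₀ ρ) := by
  unfold foldScale; fun_prop

lemma abs_coord_sub_le (x x' : EuclideanSpace ℝ (Fin n)) (i : Fin n) :
    |x i - x' i| ≤ dist x x' := by
  rw [dist_eq_norm]; exact PiLp.norm_apply_le (x - x') i

lemma abs_foldGap_sub_le (hn : 2 ≤ n) (x x' : EuclideanSpace ℝ (Fin n)) :
    |foldGap x₀ ρ θ x - foldGap x₀ ρ θ x'| ≤ 2 * dist x x' := by
  refine (abs_jumpGap_sub_le hn (C := dist x x') fun i => ?_).trans ?_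
  · rw [sub_sub_sub_cancel_right]; exact abs_coord_sub_le x x' i
  · linarith [abs_foldScale_sub_le (x₀ := x₀) (ρ := ρ) x x']

lemma foldGap_nonneg (hn : 2 ≤ n) (x : EuclideanSpace ℝ (Fin n)) : 0 ≤ foldGap x₀ ρ θ x :=
  jumpGap_nonneg hn _ _ _

lemma foldGap_le (hn : 2 ≤ n) (x : EuclideanSpace ℝ (Fin n)) :
    foldGap x₀ ρ θ x ≤ foldScale x₀ ρ x := by
  obtain ⟨i, j, -, hij⟩ := exists_secondMin_eq hn
    fun i => jumpDist (x i - θ i) (foldScale x₀ ρ x)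
  have habs := (abs_of_nonneg (foldScale_nonneg (x₀ := x₀) (ρ := ρ) x)).le
  rw [foldGap, jumpGap, hij]
  exact max_le ((jumpDist_le _ _).trans habs) ((jumpDist_le _ _).trans habs)

lemma continuous_foldGap (hn : 2 ≤ n) : Continuous (foldGap x₀ ρ θ) := by
  refine (LipschitzWith.of_dist_le_mul (K := 2) fun z w => ?_).continuous
  rw [Real.dist_eq]; exact abs_foldGap_sub_le hn z w

lemma abs_foldWindow_sub_le (hn : 2 ≤ n) (x x' : EuclideanSpace ℝ (Fin n)) :
    |foldWindow x₀ ρ θ δ x - foldWindow x₀ ρ θ δ x'| ≤ dist x x' := by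
  rw [foldWindow, foldWindow, ← sub_div, abs_div, abs_two, div_le_iff₀ two_pos]
  refine (abs_max_sub_max_le_max _ _ _ _).trans ?_
  rw [sub_self, abs_zero]
  refine max_le ?_ (by positivity)
  rw [mul_comm]; exact abs_foldGap_sub_le hn x x'

lemma continuous_foldWindow (hn : 2 ≤ n) : Continuous (foldWindow x₀ ρ θ δ) := by
  refine (LipschitzWith.of_dist_le_mul (K := 1) fun z w => ?_).continuous
  rw [Real.dist_eq, NNReal.coe_one, one_mul]; exact abs_foldWindow_sub_le hn z w

lemma half_le_foldWindow (x : EuclideanSpace ℝ (Fin n)) : δ / 2 ≤ foldWindow x₀ ρ θ δ x := by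
  rw [foldWindow]; linarith [le_max_right (foldGap x₀ ρ θ x) δ]

lemma foldGap_div_two_le (x : EuclideanSpace ℝ (Fin n)) :
    foldGap x₀ ρ θ x / 2 ≤ foldWindow x₀ ρ θ δ x := by
  rw [foldWindow]; linarith [le_max_left (foldGap x₀ ρ θ x) δ]

lemma foldRadius_pos (hρ : 0 < ρ) : 0 < foldRadius x₀ ρ θ := by
  unfold foldRadius; positivity

lemma foldCoord_of_notMem {x : EuclideanSpace ℝ (Fin n)} (hx : x ∉ Metric.ball x₀ ρ)
    (i : Fin n) : foldCoord x₀ ρ θ δ i x = 0 := by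
  rw [foldCoord, foldScale_eq_zero hx, sub_self]

lemma abs_foldCoord_le (hρ : 0 < ρ) (i : Fin n) (x : EuclideanSpace ℝ (Fin n)) :
    |foldCoord x₀ ρ θ δ i x| ≤ 2 * foldRadius x₀ ρ θ := by
  have hR := (foldRadius_pos (x₀ := x₀) (θ := θ) hρ).le
  refine (abs_sub _ _).trans ?_
  rw [two_mul]
  exact add_le_add (abs_smoothStep_le hR _ _ _) (abs_smoothStep_le hR _ _ _)

lemma abs_foldCoord_sub_le (hn : 2 ≤ n) (hρ : 0 < ρ) (hδ : 0 < δ) (i : Fin n)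
    (x x' : EuclideanSpace ℝ (Fin n)) :
    |foldCoord x₀ ρ θ δ i x - foldCoord x₀ ρ θ δ i x'| ≤
      foldRadius x₀ ρ θ / (δ / 2) * 5 * dist x x' := by
  have hR := (foldRadius_pos (x₀ := x₀) (θ := θ) hρ).le
  have hδ2 : 0 < δ / 2 := by positivity
  have h1 : |x i - θ i - (x' i - θ i)| ≤ dist x x' := by
    rw [sub_sub_sub_cancel_right]; exact abs_coord_sub_le x x' i
  have h2 := abs_foldScale_sub_le (x₀ := x₀) (ρ := ρ) x x'
  have h3 := abs_foldWindow_sub_le (x₀ := x₀) (ρ := ρ) (θ := θ) (δ := δ) hn x x'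
  have k1 := abs_smoothStep_sub_le hR hδ2 (x i - θ i) (foldScale x₀ ρ x) (x' i - θ i)
    (foldScale x₀ ρ x') (half_le_foldWindow (x₀ := x₀) (ρ := ρ) (θ := θ) x)
    (half_le_foldWindow (x₀ := x₀) (ρ := ρ) (θ := θ) x')
  have k2 := abs_smoothStep_sub_le hR hδ2 (x i - θ i) 0 (x' i - θ i)
    0 (half_le_foldWindow (x₀ := x₀) (ρ := ρ) (θ := θ) x)
    (half_le_foldWindow (x₀ := x₀) (ρ := ρ) (θ := θ) x')
  rw [sub_self (0 : ℝ), abs_zero] at k2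
  rw [foldCoord, foldCoord, sub_sub_sub_comm]
  refine (abs_sub _ _).trans ((add_le_add k1 k2).trans ?_)
  rw [← mul_add, mul_assoc]
  refine mul_le_mul_of_nonneg_left ?_ (by positivity)
  linarith

/-- `foldRadius` is large enough for the scale-zero staircase to be the identity throughout the
ball. The displacement is then the staircase minus the shifted coordinate. -/
lemma foldCoord_eq (hn : 2 ≤ n) (hρ : 0 < ρ) (hδ : δ ≤ ρ) {x : EuclideanSpace ℝ (Fin n)}
    (hx : x ∈ Metric.ball x₀ ρ) (hw : 0 < foldWindow x₀ ρ θ δ x) (i : Fin n) :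
    foldCoord x₀ ρ θ δ i x = smoothStep (foldRadius x₀ ρ θ) (x i - θ i) (foldScale x₀ ρ x)
      (foldWindow x₀ ρ θ δ x) - (x i - θ i) := by
  rw [foldCoord, smoothStep_zero hw]
  have h1 : foldWindow x₀ ρ θ δ x ≤ ρ / 2 := by
    rw [foldWindow]
    have := max_le ((foldGap_le hn x).trans (foldScale_le hρ x)) hδ (a := foldGap x₀ ρ θ x)
    linarith
  have h2 : |x i| ≤ ‖x₀‖ + ρ := by
    refine (PiLp.norm_apply_le x i).trans ?_
    have := norm_le_norm_add_norm_sub' x x₀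
    rw [← dist_eq_norm] at this
    linarith [Metric.mem_ball.1 hx]
  have h3 : |θ i| ≤ ‖θ‖ := norm_le_pi_norm θ i
  have h4 := abs_sub (x i) (θ i)
  rw [foldRadius]
  linarith

lemma eventually_foldCoord_eq (hn : 2 ≤ n) (hρ : 0 < ρ) (hδ : δ ≤ ρ)
    {x : EuclideanSpace ℝ (Fin n)} (hx : x ∈ Metric.ball x₀ ρ)
    (hw : 0 < foldWindow x₀ ρ θ δ x) (i : Fin n) :
    ∀ᶠ x' in 𝓝 x, 0 < foldWindow x₀ ρ θ δ x' ∧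
      foldCoord x₀ ρ θ δ i x' = smoothStep (foldRadius x₀ ρ θ) (x' i - θ i)
        (foldScale x₀ ρ x') (foldWindow x₀ ρ θ δ x') - (x' i - θ i) := by
  filter_upwards [Metric.isOpen_ball.mem_nhds hx,
    (continuous_foldWindow hn).continuousAt.eventually (lt_mem_nhds hw)] with x' h1 h2
  exact ⟨h2, foldCoord_eq hn hρ hδ h1 h2 i⟩

lemma fold_params_sub_le (hn : 2 ≤ n) (x x' : EuclideanSpace ℝ (Fin n)) (i : Fin n) :
    |x i - θ i - (x' i - θ i)| + |foldScale x₀ ρ x - foldScale x₀ ρ x'| +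
      |foldWindow x₀ ρ θ δ x - foldWindow x₀ ρ θ δ x'| ≤ 3 * dist x x' := by
  have h1 : |x i - θ i - (x' i - θ i)| ≤ dist x x' := by
    rw [sub_sub_sub_cancel_right]; exact abs_coord_sub_le x x' i
  linarith [abs_foldScale_sub_le (x₀ := x₀) (ρ := ρ) x x',
    abs_foldWindow_sub_le (x₀ := x₀) (ρ := ρ) (θ := θ) (δ := δ) hn x x']

lemma eventually_dist_mul_three_le (x : EuclideanSpace ℝ (Fin n)) {c : ℝ} (hc : 0 < c) :
    ∀ᶠ x' in 𝓝 x, 3 * dist x x' ≤ c := by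
  filter_upwards [Metric.ball_mem_nhds x (by positivity : 0 < c / 3)] with x' hx'
  rw [Metric.mem_ball, dist_comm] at hx'
  linarith

/-- The bound does not depend on `δ`, because the window is at least half the gap for every `δ`; it
thus dominates the whole approximating family. Position, scale and window are each 1-Lipschitz, so
the staircase contributes `3 * (2h / gap + 2)`, and the subtracted coordinate adds `1`. -/
lemma norm_fderiv_foldCoord_le (hn : 2 ≤ n) (hρ : 0 < ρ) (hδ : δ ≤ ρ)
    {x : EuclideanSpace ℝ (Fin n)} (hx : x ∈ Metric.ball x₀ ρ) (hg : 0 < foldGap x₀ ρ θ x)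
    (i : Fin n) :
    ‖fderiv ℝ (foldCoord x₀ ρ θ δ i) x‖ ≤ 6 * (foldScale x₀ ρ x / foldGap x₀ ρ θ x) + 7 := by
  have hh := foldScale_pos hx
  have hw : 0 < foldWindow x₀ ρ θ δ x := (half_pos hg).trans_le (foldGap_div_two_le x)
  refine norm_fderiv_le_of_lip' ℝ (by positivity) ?_
  filter_upwards [eventually_foldCoord_eq hn hρ hδ hx hw i, eventually_dist_mul_three_le x hw]
    with x' h1 h2
  rw [h1.2, foldCoord_eq hn hρ hδ hx hw i]
  have h3 := fold_params_sub_le (x₀ := x₀) (ρ := ρ) (θ := θ) (δ := δ) hn x x' i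
  have h4 := abs_smoothStep_sub_le_of_close (foldRadius x₀ ρ θ) hw h1.1 hh.le (h3.trans h2)
  have h5 : foldScale x₀ ρ x / foldWindow x₀ ρ θ δ x ≤
      2 * (foldScale x₀ ρ x / foldGap x₀ ρ θ x) := by
    rw [div_le_iff₀ hw]
    have h6 : foldScale x₀ ρ x = 2 * (foldScale x₀ ρ x / foldGap x₀ ρ θ x) *
        (foldGap x₀ ρ θ x / 2) := by field_simp
    conv_lhs => rw [h6]
    exact mul_le_mul_of_nonneg_left (foldGap_div_two_le x) (by positivity)
  have h7 : |x i - θ i - (x' i - θ i)| ≤ dist x x' := by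
    rw [sub_sub_sub_cancel_right]; exact abs_coord_sub_le x x' i
  rw [Real.norm_eq_abs, abs_sub_comm, sub_sub_sub_comm, ← dist_eq_norm, dist_comm x' x]
  refine (abs_sub _ _).trans ((add_le_add (h4.trans
    (mul_le_mul (add_le_add h5 le_rfl) h3 (by positivity) (by positivity))) h7).trans ?_)
  apply le_of_eq; ring

/-- The window is half the gap, so a coordinate at distance at least the gap from its jumps lies
strictly outside all ramps. Its staircase is constant nearby, and only the subtracted coordinate is
differentiated. -/
lemma hasFDerivAt_foldCoord (hn : 2 ≤ n) (hρ : 0 < ρ) (hδ : δ ≤ ρ)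
    {x : EuclideanSpace ℝ (Fin n)} (hx : x ∈ Metric.ball x₀ ρ) (hg : 0 < foldGap x₀ ρ θ x)
    (hδg : δ ≤ foldGap x₀ ρ θ x) {i : Fin n}
    (hi : foldGap x₀ ρ θ x ≤ jumpDist (x i - θ i) (foldScale x₀ ρ x)) :
    HasFDerivAt (foldCoord x₀ ρ θ δ i) (-(EuclideanSpace.proj (𝕜 := ℝ) i)) x := by
  have hweq : foldWindow x₀ ρ θ δ x = foldGap x₀ ρ θ x / 2 := by
    rw [foldWindow, max_eq_left hδg]
  have hw : 0 < foldWindow x₀ ρ θ δ x := by rw [hweq]; positivity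
  have hpos : 0 < jumpDist (x i - θ i) (foldScale x₀ ρ x) - foldWindow x₀ ρ θ δ x := by
    rw [hweq]; linarith
  set c := smoothStep (foldRadius x₀ ρ θ) (x i - θ i) (foldScale x₀ ρ x) (foldWindow x₀ ρ θ δ x)
  have h0 : HasFDerivAt (fun x' : EuclideanSpace ℝ (Fin n) => c + θ i - x' i)
      (-(EuclideanSpace.proj (𝕜 := ℝ) i)) x :=
    (EuclideanSpace.proj (𝕜 := ℝ) i).hasFDerivAt.const_sub _
  refine h0.congr_of_eventuallyEq ?_
  filter_upwards [eventually_foldCoord_eq hn hρ hδ hx hw i, eventually_dist_mul_three_le x hpos]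
    with x' h1 h2
  rw [h1.2, ← smoothStep_eq_of_close _ hw h1.1 ((fold_params_sub_le hn x x' i).trans h2)]
  ring

/-- Where the gap exceeds `δ`, the floor on the window is inactive. As `δ` decreases to zero, the
Lipschitz maps are therefore eventually equal, near such a point, to the unregularised map. -/
lemma eventually_foldCoord_eq_zero_window (hn : 2 ≤ n) {x : EuclideanSpace ℝ (Fin n)}
    (hδ : 0 ≤ δ) (hδg : δ < foldGap x₀ ρ θ x) :
    ∀ᶠ x' in 𝓝 x, ∀ i, foldCoord x₀ ρ θ δ i x' = foldCoord x₀ ρ θ 0 i x' := by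
  filter_upwards [(continuous_foldGap hn).continuousAt.eventually (lt_mem_nhds hδg)] with x' h1 i
  rw [foldCoord, foldCoord, foldWindow, foldWindow, max_eq_left h1.le,
    max_eq_left (hδ.trans h1.le)]

/-- The displacement of the folding map. -/
noncomputable def foldDisp (x₀ : EuclideanSpace ℝ (Fin n)) (ρ : ℝ) (θ : Fin n → ℝ) (δ : ℝ)
    (x : EuclideanSpace ℝ (Fin n)) : EuclideanSpace ℝ (Fin n) :=
  (EuclideanSpace.equiv (Fin n) ℝ).symm fun i => foldCoord x₀ ρ θ δ i x

lemma exists_lipschitzWith_foldDisp (hn : 2 ≤ n) (hρ : 0 < ρ) (hδ : 0 < δ) :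
    ∃ C, LipschitzWith C (foldDisp x₀ ρ θ δ) := by
  have hR := (foldRadius_pos (x₀ := x₀) (θ := θ) hρ).le
  refine ⟨_, (EuclideanSpace.equiv (Fin n) ℝ).symm.lipschitz.comp
    (LipschitzWith.of_dist_le_mul (K := (foldRadius x₀ ρ θ / (δ / 2) * 5).toNNReal)
      fun x x' => ?_)⟩
  rw [Real.coe_toNNReal _ (by positivity), dist_pi_le_iff (by positivity)]
  exact fun i => abs_foldCoord_sub_le hn hρ hδ i x x'

lemma jacobian_foldDisp {x : EuclideanSpace ℝ (Fin n)}
    (hd : DifferentiableAt ℝ (foldDisp x₀ ρ θ δ) x) (i j : Fin n) :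
    jacobian (foldDisp x₀ ρ θ δ) x i j =
      fderiv ℝ (foldCoord x₀ ρ θ δ i) x (EuclideanSpace.single j 1) := by
  have h1 : HasFDerivAt (foldCoord x₀ ρ θ δ i)
      ((EuclideanSpace.proj (𝕜 := ℝ) i).comp (fderiv ℝ (foldDisp x₀ ρ θ δ) x)) x :=
    (EuclideanSpace.proj (𝕜 := ℝ) i).hasFDerivAt.comp x hd.hasFDerivAt
  rw [h1.fderiv]; rfl

lemma jacobian_toEuclideanLin_comp (ξ : Matrix (Fin N) (Fin n) ℝ)
    {g : EuclideanSpace ℝ (Fin n) → EuclideanSpace ℝ (Fin n)} {x : EuclideanSpace ℝ (Fin n)}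
    (hd : DifferentiableAt ℝ g x) :
    jacobian (fun x => Matrix.toEuclideanLin ξ (g x)) x = ξ * jacobian g x := by
  have h1 : HasFDerivAt (fun x => Matrix.toEuclideanLin ξ (g x))
      ((Matrix.toEuclideanLin ξ).toContinuousLinearMap.comp (fderiv ℝ g x)) x :=
    (Matrix.toEuclideanLin ξ).toContinuousLinearMap.hasFDerivAt.comp x hd.hasFDerivAt
  ext i j
  rw [jacobian, Matrix.of_apply, h1.fderiv, Matrix.mul_apply]
  simp [Matrix.toLpLin_apply, Matrix.mulVec, dotProduct, jacobian]

lemma rank_le_one_of_rows_eq_zero {M : Matrix (Fin n) (Fin n) ℝ} (i₀ : Fin n)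
    (h : ∀ i, i ≠ i₀ → ∀ j, M i j = 0) : M.rank ≤ 1 := by
  have : M = Matrix.vecMulVec (Pi.single i₀ 1) (M i₀) := by
    ext i j
    rw [Matrix.vecMulVec_apply]
    rcases eq_or_ne i i₀ with rfl | hi
    · simp
    · simp [hi, h i hi j]
  rw [this]
  exact Matrix.rank_vecMulVec_le _ _

lemma abs_jacobian_foldDisp_le (hn : 2 ≤ n) (hρ : 0 < ρ) (hδ : δ ≤ ρ)
    {x : EuclideanSpace ℝ (Fin n)} (hx : x ∈ Metric.ball x₀ ρ) (hg : 0 < foldGap x₀ ρ θ x)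
    (hd : DifferentiableAt ℝ (foldDisp x₀ ρ θ δ) x) (i j : Fin n) :
    |jacobian (foldDisp x₀ ρ θ δ) x i j| ≤
      6 * (foldScale x₀ ρ x / foldGap x₀ ρ θ x) + 7 := by
  rw [jacobian_foldDisp hd]
  refine ((fderiv ℝ (foldCoord x₀ ρ θ δ i) x).le_opNorm _).trans ?_
  rw [PiLp.norm_single, norm_one, mul_one]
  exact norm_fderiv_foldCoord_le hn hρ hδ hx hg i

/-- Every coordinate except the one nearest to a jump has derivative cancelling that of the
identity, so at most one row survives. -/
lemma rank_one_add_jacobian_foldDisp_le (hn : 2 ≤ n) (hρ : 0 < ρ)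
    {x : EuclideanSpace ℝ (Fin n)} (hx : x ∈ Metric.ball x₀ ρ) (hg : 0 < foldGap x₀ ρ θ x)
    (hd : DifferentiableAt ℝ (foldDisp x₀ ρ θ 0) x) :
    (1 + jacobian (foldDisp x₀ ρ θ 0) x).rank ≤ 1 := by
  obtain ⟨i₀, hi₀⟩ := exists_forall_ne_secondMin_le hn
    fun i => jumpDist (x i - θ i) (foldScale x₀ ρ x)
  refine rank_le_one_of_rows_eq_zero i₀ fun i hi j => ?_
  rw [Matrix.add_apply, jacobian_foldDisp hd,
    (hasFDerivAt_foldCoord hn hρ hρ.le hx hg hg.le (hi₀ i hi)).fderiv]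
  simp [Matrix.one_apply]

end Fold

/-! ### Integrability of the fold and construction of the competitor. -/

section RankOneCompetitor

open Filter Topology

variable {n N : ℕ}

/-- The averaged estimate is used with `q = p / 2 < 1`. The constant depends only on `n` and `p`,
never on the ball; this uniformity becomes the constant of the linear growth. -/
lemma exists_foldGap_bounds (hn : 2 ≤ n) {p : ℝ≥0∞} (hp1 : 1 ≤ p) (hp2 : p < 2) :
    ∃ K : ℝ, ∀ (Ω : Set (EuclideanSpace ℝ (Fin n))) (x₀ : EuclideanSpace ℝ (Fin n)) (ρ : ℝ),
      0 < ρ → ∃ θ : Fin n → ℝ,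
        (∀ᵐ x ∂volume.restrict (Metric.ball x₀ ρ), 0 < foldGap x₀ ρ θ x) ∧
        MemLp (fun x => foldScale x₀ ρ x / foldGap x₀ ρ θ x) p (volume.restrict Ω) ∧
        ∫ x in Metric.ball x₀ ρ, foldScale x₀ ρ x / foldGap x₀ ρ θ x ≤
          K * volume.real (Metric.ball x₀ ρ) := by
  have hptop : p ≠ ⊤ := hp2.ne_top
  have hp0 : p ≠ 0 := (zero_lt_one.trans_le hp1).ne'
  have hpr1 : 1 ≤ p.toReal := by simpa using ENNReal.toReal_mono hptop hp1
  have hpr2 : p.toReal < 2 := by simpa using ENNReal.toReal_strict_mono (by simp) hp2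
  set A : ℝ := n ^ 2 * (64 / (1 - p.toReal / 2)) ^ 2 with hA
  have hA0 : 0 ≤ A := by positivity
  refine ⟨1 + A, fun Ω x₀ ρ hρ => ?_⟩
  set B := Metric.ball x₀ ρ with hB
  have hBfin : volume B ≠ ⊤ := Metric.isBounded_ball.measure_lt_top.ne
  obtain ⟨θ, hθ⟩ := exists_lintegral_div_jumpGap_rpow_le hn hρ (q := p.toReal / 2) (by linarith)
    (by linarith) (B := B) Metric.isOpen_ball.measurableSet
    (continuous_foldScale (x₀ := x₀) (ρ := ρ)) fun x hx => ⟨foldScale_pos hx, foldScale_le hρ x⟩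
  rw [mul_div_cancel₀ _ (two_ne_zero)] at hθ
  change ∫⁻ x in B, (ENNReal.ofReal (foldScale x₀ ρ x) / ENNReal.ofReal (foldGap x₀ ρ θ x)) ^
    p.toReal ≤ ENNReal.ofReal A * volume B at hθ
  have hθfin := hθ.trans_lt (ENNReal.mul_lt_top ENNReal.ofReal_lt_top hBfin.lt_top)
  have hsm : Measurable (foldScale x₀ ρ) := continuous_foldScale.measurable
  have hgm : Measurable (foldGap x₀ ρ θ) := (continuous_foldGap hn).measurable
  have hH0 : ∀ x, 0 ≤ foldScale x₀ ρ x / foldGap x₀ ρ θ x := fun x =>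
    div_nonneg (foldScale_nonneg x) (foldGap_nonneg hn x)
  -- Only an inequality: at a zero gap the real quotient is `0`, whereas the extended one is
  -- infinite inside the ball. The extended quotient is the one that detects a vanishing gap.
  have hHle : ∀ x, ENNReal.ofReal (foldScale x₀ ρ x / foldGap x₀ ρ θ x) ≤
      ENNReal.ofReal (foldScale x₀ ρ x) / ENNReal.ofReal (foldGap x₀ ρ θ x) := fun x => by
    rcases (foldGap_nonneg (x₀ := x₀) (ρ := ρ) (θ := θ) hn x).eq_or_lt with h | h
    · rw [← h]; simp
    · rw [ENNReal.ofReal_div_of_pos h]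
  refine ⟨θ, ?_, ⟨(hsm.div hgm).aestronglyMeasurable, ?_⟩, ?_⟩
  -- A finite integral makes the extended quotient finite almost everywhere, which excludes a zero
  -- gap because the scale is positive in the ball.
  · have hae := ae_lt_top' (((hsm.ennreal_ofReal.div hgm.ennreal_ofReal).pow_const _).aemeasurable)
      hθfin.ne
    filter_upwards [hae, ae_restrict_mem Metric.isOpen_ball.measurableSet] with x hx hxB
    refine lt_of_le_of_ne (foldGap_nonneg hn x) fun h0 => ?_
    rw [Pi.div_apply, ← h0, ENNReal.ofReal_zero, ENNReal.div_zero
      (by simpa using foldScale_pos hxB), ENNReal.top_rpow_of_pos (by linarith)] at hx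
    exact lt_irrefl _ hx
  · rw [eLpNorm_lt_top_iff_lintegral_rpow_enorm_lt_top hp0 hptop]
    calc ∫⁻ x in Ω, ‖foldScale x₀ ρ x / foldGap x₀ ρ θ x‖ₑ ^ p.toReal
        ≤ ∫⁻ x, ‖foldScale x₀ ρ x / foldGap x₀ ρ θ x‖ₑ ^ p.toReal := setLIntegral_le_lintegral _ _
      _ = ∫⁻ x in B, ‖foldScale x₀ ρ x / foldGap x₀ ρ θ x‖ₑ ^ p.toReal := by
          refine (setLIntegral_eq_of_support_subset fun x hx => ?_).symm
          by_contra hxB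
          refine hx ?_
          simp only [foldScale_eq_zero hxB, zero_div, enorm_zero]
          exact ENNReal.zero_rpow_of_pos (by linarith)
      _ ≤ _ := by
          refine lintegral_mono fun x => ?_
          gcongr
          rw [Real.enorm_eq_ofReal (hH0 x)]
          exact hHle x
      _ < ⊤ := hθfin
  · rw [integral_eq_lintegral_of_nonneg_ae (Eventually.of_forall hH0)
      (hsm.div hgm).aestronglyMeasurable]
    have hle : ∫⁻ x in B, ENNReal.ofReal (foldScale x₀ ρ x / foldGap x₀ ρ θ x) ≤
        ENNReal.ofReal (1 + A) * volume B := by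
      calc _ ≤ ∫⁻ x in B, (1 + (ENNReal.ofReal (foldScale x₀ ρ x) /
              ENNReal.ofReal (foldGap x₀ ρ θ x)) ^ p.toReal) := by
            refine lintegral_mono fun x => (hHle x).trans ?_
            -- The elementary bound `t ≤ 1 + t ^ p` for `p ≥ 1`, which explains `1 + A`.
            rcases le_total (ENNReal.ofReal (foldScale x₀ ρ x) /
              ENNReal.ofReal (foldGap x₀ ρ θ x)) 1 with h | h
            · exact h.trans le_self_add
            · refine le_trans ?_ le_add_self
              conv_lhs => rw [← ENNReal.rpow_one (ENNReal.ofReal _ / _)]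
              exact ENNReal.rpow_le_rpow_of_exponent_le h hpr1
        _ ≤ volume B + ENNReal.ofReal A * volume B := by
            rw [lintegral_add_left measurable_const, setLIntegral_const, one_mul]
            gcongr
        _ = _ := by
            rw [ENNReal.ofReal_add zero_le_one hA0, ENNReal.ofReal_one, add_mul, one_mul]
    refine (ENNReal.toReal_mono (ENNReal.mul_ne_top ENNReal.ofReal_ne_top hBfin) hle).trans ?_
    rw [ENNReal.toReal_mul, ENNReal.toReal_ofReal (by linarith), measureReal_def]

/-- Competitors with zero boundary values on a ball whose total gradient `ξ + ∇φ` has rank at most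
one, with integral controlled linearly in `ξ`. -/
lemma exists_rank_one_competitor (hn : 2 ≤ n) {p : ℝ≥0∞} (hp1 : 1 ≤ p) (hp2 : p < 2) :
    ∃ K : ℝ, ∀ (ξ : Matrix (Fin N) (Fin n) ℝ) (Ω : Set (EuclideanSpace ℝ (Fin n)))
      (x₀ : EuclideanSpace ℝ (Fin n)) (ρ : ℝ), IsOpen Ω → Bornology.IsBounded Ω → 0 < ρ →
      Metric.closedBall x₀ ρ ⊆ Ω →
      ∃ (φ : EuclideanSpace ℝ (Fin n) → EuclideanSpace ℝ (Fin N))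
        (G : EuclideanSpace ℝ (Fin n) → Matrix (Fin N) (Fin n) ℝ)
        (b : EuclideanSpace ℝ (Fin n) → ℝ), MemW1pZero p Ω φ G ∧
        (∀ x ∉ Metric.closedBall x₀ ρ, G x = 0) ∧
        IntegrableOn b (Metric.ball x₀ ρ) ∧
        (∀ᵐ x ∂volume.restrict (Metric.ball x₀ ρ), ∃ M : Matrix (Fin n) (Fin n) ℝ,
          ξ + G x = ξ * M ∧ M.rank ≤ 1 ∧ ∀ i j, |M i j| ≤ b x) ∧
        ∫ x in Metric.ball x₀ ρ, b x ≤ K * volume.real (Metric.ball x₀ ρ) := by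
  obtain ⟨K, hK⟩ := exists_foldGap_bounds hn hp1 hp2
  refine ⟨6 * K + 8, fun ξ Ω x₀ ρ hΩ hΩb hρ hsub => ?_⟩
  have hptop : p ≠ ⊤ := hp2.ne_top
  have hfinΩ : IsFiniteMeasure (volume.restrict Ω) := ⟨by simpa using hΩb.measure_lt_top⟩
  obtain ⟨θ, hgap, hmem, hint⟩ := hK Ω x₀ ρ hρ
  set B := Metric.ball x₀ ρ with hB
  have hBΩ : B ⊆ Ω := Metric.ball_subset_closedBall.trans hsub
  have hBfin : volume B ≠ ⊤ := Metric.isBounded_ball.measure_lt_top.ne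
  have hfinB : IsFiniteMeasure (volume.restrict B) := ⟨by simpa using hBfin.lt_top⟩
  set H : EuclideanSpace ℝ (Fin n) → ℝ := fun x => foldScale x₀ ρ x / foldGap x₀ ρ θ x with hH
  have hH0 : ∀ x, 0 ≤ H x := fun x => div_nonneg (foldScale_nonneg x) (foldGap_nonneg hn x)
  have hHint : IntegrableOn H B :=
    (show IntegrableOn H Ω volume from hmem.integrable hp1).mono_set hBΩ
  set T := (Matrix.toEuclideanLin ξ).toContinuousLinearMap with hT
  set u : ℝ → EuclideanSpace ℝ (Fin n) → EuclideanSpace ℝ (Fin N) := fun δ x =>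
    Matrix.toEuclideanLin ξ (foldDisp x₀ ρ θ δ x) with hu
  -- Floors on the window: each `u (δ k)` is Lipschitz, whereas the limit `u 0` need not be.
  set δ : ℕ → ℝ := fun k => ρ / (k + 1) with hδ
  have hδ0 : ∀ k, 0 < δ k := fun k => by positivity
  have hδρ : ∀ k, δ k ≤ ρ := fun k => div_le_self hρ.le (by
    linarith [(Nat.cast_nonneg k : (0 : ℝ) ≤ k)])
  have hδlim : Tendsto δ atTop (𝓝 0) := by
    simpa [hδ, div_eq_mul_inv] using (tendsto_one_div_add_atTop_nhds_zero_nat (𝕜 := ℝ)).const_mul ρ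
  choose C hC using fun k => exists_lipschitzWith_foldDisp (x₀ := x₀) (θ := θ) hn hρ (hδ0 k)
  have hzero : ∀ δ, ∀ x ∉ B, foldDisp x₀ ρ θ δ x = 0 := fun δ x hx => by
    have : (fun i => foldCoord x₀ ρ θ δ i x) = 0 := funext fun i => foldCoord_of_notMem hx i
    rw [foldDisp, this, map_zero]
  have hjac0 : ∀ δ, ∀ x ∉ Metric.closedBall x₀ ρ, jacobian (u δ) x = 0 := fun δ x hx => by
    have h1 : u δ =ᶠ[𝓝 x] fun _ => 0 := by
      filter_upwards [Metric.isClosed_closedBall.isOpen_compl.mem_nhds hx] with x' hx'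
      have := hzero δ x' fun h => hx' (Metric.ball_subset_closedBall h)
      simp [hu, this]
    ext i j
    simp [jacobian, h1.fderiv_eq]
  have hev : ∀ x, 0 < foldGap x₀ ρ θ x → ∀ᶠ k in atTop,
      foldDisp x₀ ρ θ (δ k) =ᶠ[𝓝 x] foldDisp x₀ ρ θ 0 := fun x hx => by
    filter_upwards [hδlim.eventually (gt_mem_nhds hx)] with k hk
    filter_upwards [eventually_foldCoord_eq_zero_window hn (hδ0 k).le hk] with x' hx'
    simp only [foldDisp, hx']
  have hsphere : ∀ᵐ x : EuclideanSpace ℝ (Fin n), x ∉ Metric.sphere x₀ ρ := by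
    have : Nontrivial (EuclideanSpace ℝ (Fin n)) :=
      Module.nontrivial_of_finrank_pos (R := ℝ) (by simp; omega)
    exact compl_mem_ae_iff.2 (Measure.addHaar_sphere volume x₀ ρ)
  have hgap' : ∀ᵐ x, x ∈ B → 0 < foldGap x₀ ρ θ x :=
    (ae_restrict_iff' Metric.isOpen_ball.measurableSet).1 hgap
  have hdiff : ∀ᵐ x : EuclideanSpace ℝ (Fin n), ∀ k,
      DifferentiableAt ℝ (foldDisp x₀ ρ θ (δ k)) x :=
    ae_all_iff.2 fun k => (hC k).ae_differentiableAt
  set m : ℝ := ∑ i, ∑ j, |ξ i j| with hm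
  have hm0 : 0 ≤ m := by positivity
  have hrow : ∀ i, ∑ j, |ξ i j| ≤ m := fun i =>
    Finset.single_le_sum (f := fun i => ∑ j, |ξ i j|) (fun _ _ => by positivity) (Finset.mem_univ i)
  have hgl : MemLp (fun x => m * (6 * H x + 7)) p (volume.restrict Ω) :=
    ((hmem.const_mul 6).add (memLp_const 7)).const_mul m
  refine ⟨u 0, jacobian (u 0), fun x => 6 * H x + 8, ?_, hjac0 0,
    (hHint.const_mul 6).add (integrable_const 8), ?_, ?_⟩
  · refine memW1pZero_of_lipschitz_approx hp1 hptop hΩ hΩb (φs := fun k => u (δ k))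
      (fun k => T.lipschitz.comp (hC k)) (isCompact_closedBall x₀ ρ) hsub (fun k x hx => ?_)
      (M := ‖T‖ * (‖((EuclideanSpace.equiv (Fin n) ℝ).symm :
        (Fin n → ℝ) →L[ℝ] EuclideanSpace ℝ (Fin n))‖ * (2 * foldRadius x₀ ρ θ)))
      (fun k x => ?_) hgl (fun k => ?_) ?_
    · have := hzero (δ k) x fun h => hx (Metric.ball_subset_closedBall h)
      simp [hu, this]
    · refine (T.le_opNorm _).trans (mul_le_mul_of_nonneg_left ?_ (norm_nonneg _))
      refine (ContinuousLinearMap.le_opNorm ((EuclideanSpace.equiv (Fin n) ℝ).symm :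
        (Fin n → ℝ) →L[ℝ] EuclideanSpace ℝ (Fin n)) _).trans
        (mul_le_mul_of_nonneg_left ?_ (norm_nonneg _))
      have := foldRadius_pos (x₀ := x₀) (θ := θ) hρ
      exact (pi_norm_le_iff_of_nonneg (by positivity)).2 fun i => abs_foldCoord_le hρ i x
    · refine ae_restrict_of_ae ?_
      filter_upwards [hsphere, hgap', hdiff] with x hx1 hx2 hx3 i j
      by_cases hxB : x ∈ B
      · rw [jacobian_toEuclideanLin_comp ξ (hx3 k), Matrix.mul_apply]
        refine (Finset.abs_sum_le_sum_abs _ _).trans ?_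
        calc _ ≤ ∑ l, |ξ i l| * (6 * H x + 7) := by
              refine Finset.sum_le_sum fun l _ => ?_
              rw [abs_mul]
              exact mul_le_mul_of_nonneg_left
                (abs_jacobian_foldDisp_le hn hρ (hδρ k) hxB (hx2 hxB) (hx3 k) l j) (abs_nonneg _)
          _ ≤ _ := by
              rw [← Finset.sum_mul]
              exact mul_le_mul_of_nonneg_right (hrow i) (by linarith [hH0 x])
      · have hxc : x ∉ Metric.closedBall x₀ ρ := fun h => by
          rcases (Metric.mem_closedBall.1 h).lt_or_eq with h | h
          · exact hxB h
          · exact hx1 h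
        rw [hjac0 (δ k) x hxc, Matrix.zero_apply, abs_zero]
        exact mul_nonneg hm0 (by linarith [hH0 x])
    · refine ae_restrict_of_ae ?_
      filter_upwards [hsphere, hgap'] with x hx1 hx2
      by_cases hxB : x ∈ B
      · filter_upwards [hev x (hx2 hxB)] with k hk
        have h2 : u (δ k) =ᶠ[𝓝 x] u 0 := hk.fun_comp (Matrix.toEuclideanLin ξ)
        exact ⟨h2.eq_of_nhds, by ext i j; simp [jacobian, h2.fderiv_eq]⟩
      · have hxc : x ∉ Metric.closedBall x₀ ρ := fun h => by
          rcases (Metric.mem_closedBall.1 h).lt_or_eq with h | h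
          · exact hxB h
          · exact hx1 h
        refine Eventually.of_forall fun k => ⟨?_, by rw [hjac0 _ x hxc, hjac0 _ x hxc]⟩
        simp only [hu, hzero _ x hxB]
  · filter_upwards [hgap, ae_restrict_mem Metric.isOpen_ball.measurableSet,
      ae_restrict_of_ae hdiff] with x hx hxB hd
    obtain ⟨k, hk⟩ := (hev x hx).exists
    -- Rademacher's theorem applies only to the Lipschitz maps with positive floor; `foldDisp` with
    -- floor `0` inherits differentiability by agreeing with one of them near `x`.
    have hd0 : DifferentiableAt ℝ (foldDisp x₀ ρ θ 0) x := (hd k).congr_of_eventuallyEq hk.symm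
    refine ⟨1 + jacobian (foldDisp x₀ ρ θ 0) x, ?_,
      rank_one_add_jacobian_foldDisp_le hn hρ hxB hx hd0, fun i j => ?_⟩
    · rw [jacobian_toEuclideanLin_comp ξ hd0, Matrix.mul_add, Matrix.mul_one]
    · rw [Matrix.add_apply]
      refine (abs_add_le _ _).trans ?_
      have h1 := abs_jacobian_foldDisp_le hn hρ hρ.le hxB hx hd0 i j
      have h2 : |(1 : Matrix (Fin n) (Fin n) ℝ) i j| ≤ 1 := by
        rw [Matrix.one_apply]; split_ifs <;> simp
      simp only [hH]
      linarith
  · rw [integral_add (hHint.const_mul 6) (integrable_const 8), integral_const_mul]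
    simp only [integral_const, measureReal_restrict_apply_univ, smul_eq_mul]
    linarith

end RankOneCompetitor

/-! ### Linear growth and quasiconvexity on `W^{1,1}_0`. -/

section Quasiconvexity

open Filter Topology

variable {n N : ℕ}

lemma extIntegral_eq_coe_integral {α : Type*} [MeasurableSpace α] {μ : Measure α} {g : α → ℝ}
    (hg : Integrable g μ) : extIntegral μ g = ((∫ x, g x ∂μ : ℝ) : EReal) := by
  have h1 : ∫⁻ x, ENNReal.ofReal (g x) ∂μ ≠ ⊤ := hg.lintegral_lt_top.ne
  have h2 : ∫⁻ x, ENNReal.ofReal (-g x) ∂μ ≠ ⊤ := hg.neg.lintegral_lt_top.ne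
  rw [extIntegral, integral_eq_lintegral_pos_part_sub_lintegral_neg_part hg, EReal.coe_sub,
    EReal.coe_ennreal_toReal h1, EReal.coe_ennreal_toReal h2]

lemma aestronglyMeasurable_comp_matrix {α : Type*} [MeasurableSpace α] {μ : Measure α}
    {f : Matrix (Fin N) (Fin n) ℝ → ℝ} (hf : Continuous f) (ξ : Matrix (Fin N) (Fin n) ℝ)
    {G : α → Matrix (Fin N) (Fin n) ℝ} (hG : ∀ i j, AEStronglyMeasurable (fun x => G x i j) μ) :
    AEStronglyMeasurable (fun x => f (ξ + G x)) μ := by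
  have h1 : Continuous fun v : Fin N → Fin n → ℝ => f (ξ + Matrix.of v) :=
    hf.comp (continuous_const.add continuous_id)
  have h2 : AEMeasurable (fun x => (fun i j => G x i j : Fin N → Fin n → ℝ)) μ :=
    aemeasurable_pi_lambda _ fun i => aemeasurable_pi_lambda _ fun j => (hG i j).aemeasurable
  exact (h1.measurable.comp_aemeasurable h2).aestronglyMeasurable

lemma matrixNorm_nonneg (ξ : Matrix (Fin N) (Fin n) ℝ) : 0 ≤ matrixNorm ξ := Real.sqrt_nonneg _

lemma abs_apply_le_matrixNorm (ξ : Matrix (Fin N) (Fin n) ℝ) (i : Fin N) (j : Fin n) :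
    |ξ i j| ≤ matrixNorm ξ := by
  refine Real.abs_le_sqrt ?_
  exact (Finset.single_le_sum (f := fun j => ξ i j ^ 2) (fun _ _ => sq_nonneg _)
    (Finset.mem_univ j)).trans (Finset.single_le_sum (f := fun i => ∑ j, ξ i j ^ 2)
      (fun _ _ => Finset.sum_nonneg fun _ _ => sq_nonneg _) (Finset.mem_univ i))

lemma matrixNorm_le_sum_abs (ξ : Matrix (Fin N) (Fin n) ℝ) :
    matrixNorm ξ ≤ ∑ i, ∑ j, |ξ i j| := by
  refine Real.sqrt_le_iff.2 ⟨by positivity, ?_⟩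
  rw [← Fintype.sum_prod_type' (f := fun i j => ξ i j ^ 2),
    ← Fintype.sum_prod_type' (f := fun i j => |ξ i j|)]
  simp_rw [← sq_abs (ξ _ _)]
  exact Finset.sum_sq_le_sq_sum_of_nonneg fun _ _ => abs_nonneg _

lemma matrixNorm_mul_le (ξ : Matrix (Fin N) (Fin n) ℝ) {M : Matrix (Fin n) (Fin n) ℝ} {b : ℝ}
    (hM : ∀ i j, |M i j| ≤ b) : matrixNorm (ξ * M) ≤ N * (n * (n * (matrixNorm ξ * b))) := by
  refine (matrixNorm_le_sum_abs _).trans ?_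
  have h : ∀ i j, |(ξ * M) i j| ≤ n * (matrixNorm ξ * b) := fun i j => by
    rw [Matrix.mul_apply]
    refine (Finset.abs_sum_le_sum_abs _ _).trans
      ((Finset.sum_le_card_nsmul _ _ (matrixNorm ξ * b) fun k _ => ?_).trans (by simp))
    rw [abs_mul]
    exact mul_le_mul (abs_apply_le_matrixNorm ξ i k) (hM k j) (abs_nonneg _) (matrixNorm_nonneg ξ)
  refine (Finset.sum_le_sum fun i _ => Finset.sum_le_sum fun j _ => h i j).trans ?_
  simp

/-- Linear growth on matrices of rank at most one implies linear growth. -/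
lemma IsW1pQuasiconvex.exists_linear_growth {p : ℝ≥0∞} (hp1 : 1 ≤ p) (hp2 : p < 2)
    {f : Matrix (Fin N) (Fin n) ℝ → ℝ} (hf : Continuous f) (hqc : IsW1pQuasiconvex p f) {L : ℝ}
    (hL : ∀ ξ : Matrix (Fin N) (Fin n) ℝ, ξ.rank ≤ 1 → f ξ ≤ L * (1 + matrixNorm ξ)) :
    ∃ L' : ℝ, 0 ≤ L' ∧ ∀ ξ : Matrix (Fin N) (Fin n) ℝ, f ξ ≤ L' * (1 + matrixNorm ξ) := by
  have habs : ∀ ξ : Matrix (Fin N) (Fin n) ℝ, ξ.rank ≤ 1 → f ξ ≤ |L| * (1 + matrixNorm ξ) :=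
    fun ξ hξ => (hL ξ hξ).trans (mul_le_mul_of_nonneg_right (le_abs_self L)
      (by linarith [matrixNorm_nonneg ξ]))
  rcases Nat.lt_or_ge n 2 with hn | hn
  -- With at most one column every matrix has rank at most one.
  · exact ⟨|L|, abs_nonneg L, fun ξ => habs ξ ((Matrix.rank_le_width ξ).trans (by omega))⟩
  obtain ⟨K, hK⟩ := exists_rank_one_competitor (N := N) hn hp1 hp2
  obtain ⟨m₀, hm₀⟩ := hqc.bddBelow
  set c : ℝ := N * (n * n) with hc
  refine ⟨|L| * (1 + |c * K|), by positivity, fun ξ => ?_⟩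
  obtain ⟨Ω, ⟨x₀, hx₀⟩, hΩb, hΩ, -, hΩqc⟩ := hqc.quasiconvexAt ξ
  obtain ⟨ρ, hρ, hsub⟩ := Metric.nhds_basis_closedBall.mem_iff.1 (hΩ.mem_nhds hx₀)
  obtain ⟨φ, G, b, hφ, hG0, hb, hM, hbK⟩ := hK ξ Ω x₀ ρ hΩ hΩb hρ hsub
  set B := Metric.ball x₀ ρ with hB
  have hBΩ : B ⊆ Ω := Metric.ball_subset_closedBall.trans hsub
  have hBm : MeasurableSet B := Metric.isOpen_ball.measurableSet
  have hBfin : volume B ≠ ⊤ := Metric.isBounded_ball.measure_lt_top.ne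
  have hfinB : IsFiniteMeasure (volume.restrict B) := ⟨by simpa using hBfin.lt_top⟩
  have hΩfin : volume Ω ≠ ⊤ := hΩb.measure_lt_top.ne
  have hFm : AEStronglyMeasurable (fun x => f (ξ + G x)) (volume.restrict Ω) :=
    aestronglyMeasurable_comp_matrix hf ξ fun i j => (hφ.memW1p.memLp_gradient i j).1
  set g : EuclideanSpace ℝ (Fin n) → ℝ := fun x => |L| * (1 + c * matrixNorm ξ * b x) with hg
  have hgint : IntegrableOn g B :=
    ((integrable_const 1).add (hb.const_mul (c * matrixNorm ξ))).const_mul |L|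
  have hle : ∀ᵐ x ∂volume.restrict B, f (ξ + G x) ≤ g x := by
    filter_upwards [hM] with x ⟨M, hxM, hrank, hMb⟩
    rw [hxM]
    refine (habs _ ((Matrix.rank_mul_le_right ξ M).trans hrank)).trans
      (mul_le_mul_of_nonneg_left ?_ (abs_nonneg L))
    have := matrixNorm_mul_le ξ hMb
    rw [hc]
    linarith
  have hFB : IntegrableOn (fun x => f (ξ + G x)) B := by
    refine (hgint.norm.add (integrable_const |m₀|)).mono' (hFm.mono_set hBΩ) ?_
    filter_upwards [hle] with x hx
    have h1 : m₀ ≤ f (ξ + G x) := hm₀ ⟨_, rfl⟩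
    have h2 := neg_abs_le m₀
    have h3 := le_abs_self (g x)
    rw [Real.norm_eq_abs, abs_le]
    simp only [Pi.add_apply, Real.norm_eq_abs]
    constructor <;> linarith [abs_nonneg (g x), abs_nonneg m₀]
  have hsphere : volume (Metric.sphere x₀ ρ) = 0 := by
    have : Nontrivial (EuclideanSpace ℝ (Fin n)) :=
      Module.nontrivial_of_finrank_pos (R := ℝ) (by simp; omega)
    exact Measure.addHaar_sphere volume x₀ ρ
  have hout : (fun _ => f ξ) =ᵐ[volume.restrict (Ω \ B)] fun x => f (ξ + G x) := by
    refine (ae_restrict_iff' (hΩ.measurableSet.diff hBm)).2 ?_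
    filter_upwards [compl_mem_ae_iff.2 hsphere] with x hx1 hx2
    rw [hG0 x fun h => (Metric.mem_closedBall.1 h).lt_or_eq.elim (fun h => hx2.2 h) hx1, add_zero]
  have hdfin : volume (Ω \ B) ≠ ⊤ := ne_top_of_le_ne_top hΩfin (measure_mono sdiff_subset)
  have hFd : IntegrableOn (fun x => f (ξ + G x)) (Ω \ B) :=
    (integrableOn_const hdfin).congr hout
  have hFΩ : IntegrableOn (fun x => f (ξ + G x)) Ω := by
    rw [← union_sdiff_cancel hBΩ]; exact hFB.union hFd
  have key := hΩqc φ G hφ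
  rw [extIntegral_eq_coe_integral hFΩ, EReal.coe_le_coe_iff] at key
  -- The competitor has zero gradient almost everywhere outside the ball, so the term over `Ω \ B`
  -- cancels against the same share of `volume.real Ω * f ξ`. What remains is the inequality on the
  -- ball alone, whatever `Ω` is.
  have hsplit : ∫ x in Ω, f (ξ + G x) = (∫ x in B, f (ξ + G x)) + volume.real (Ω \ B) * f ξ := by
    conv_lhs => rw [← union_sdiff_cancel hBΩ]
    rw [setIntegral_union disjoint_sdiff_right (hΩ.measurableSet.diff hBm) hFB hFd,
      ← integral_congr_ae hout, setIntegral_const, smul_eq_mul]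
  have hvol : volume.real (Ω \ B) = volume.real Ω - volume.real B :=
    measureReal_sdiff hBΩ hBm hΩfin
  have hFle : ∫ x in B, f (ξ + G x) ≤ |L| * (volume.real B + c * matrixNorm ξ * ∫ x in B, b x) := by
    refine (integral_mono_ae hFB hgint hle).trans (le_of_eq ?_)
    rw [hg, integral_const_mul, integral_add (integrable_const 1) (hb.const_mul _),
      integral_const_mul]
    simp
  have hBpos : 0 < volume.real B :=
    ENNReal.toReal_pos (Metric.measure_ball_pos volume x₀ hρ).ne' hBfin
  have hξ0 := matrixNorm_nonneg ξ
  have hc0 : 0 ≤ c := by positivity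
  have h1 : volume.real B * f ξ ≤ volume.real B * (|L| * (1 + c * K * matrixNorm ξ)) := by
    have h2 : c * matrixNorm ξ * ∫ x in B, b x ≤ c * matrixNorm ξ * (K * volume.real B) :=
      mul_le_mul_of_nonneg_left hbK (by positivity)
    have h3 := mul_le_mul_of_nonneg_left (add_le_add (le_refl (volume.real B)) h2) (abs_nonneg L)
    rw [hsplit, hvol] at key
    linarith
  refine (le_of_mul_le_mul_left h1 hBpos).trans ?_
  rw [mul_assoc |L|]
  refine mul_le_mul_of_nonneg_left ?_ (abs_nonneg L)
  have h4 : c * K * matrixNorm ξ ≤ |c * K| * matrixNorm ξ :=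
    mul_le_mul_of_nonneg_right (le_abs_self _) hξ0
  nlinarith [abs_nonneg (c * K)]

/-- For integrands of linear growth, quasiconvexity extends from test maps to `W^{1,1}_0`. -/
lemma IsW1pQuasiconvex.one_of_linear_growth {p : ℝ≥0∞} (hp1 : 1 ≤ p)
    {f : Matrix (Fin N) (Fin n) ℝ → ℝ} (hf : Continuous f) (hqc : IsW1pQuasiconvex p f) {L : ℝ}
    (hL0 : 0 ≤ L) (hL : ∀ ξ : Matrix (Fin N) (Fin n) ℝ, f ξ ≤ L * (1 + matrixNorm ξ)) :
    IsW1pQuasiconvex 1 f := by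
  refine ⟨hqc.measurable, hqc.bddBelow, fun ξ => ?_⟩
  obtain ⟨m₀, hm₀⟩ := hqc.bddBelow
  obtain ⟨Ω, hne, hΩb, hΩ, hfr, hΩqc⟩ := hqc.quasiconvexAt ξ
  refine ⟨Ω, hne, hΩb, hΩ, hfr, fun φ G hφ => ?_⟩
  have hfinΩ : IsFiniteMeasure (volume.restrict Ω) := ⟨by simpa using hΩb.measure_lt_top⟩
  set μ := volume.restrict Ω with hμ
  have hGi : ∀ i j, Integrable (fun x => G x i j) μ := fun i j =>
    memLp_one_iff_integrable.1 (hφ.memW1p.memLp_gradient i j)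
  have hbound : ∀ M : Matrix (Fin N) (Fin n) ℝ,
      |f (ξ + M)| ≤ |m₀| + L * (1 + ∑ i, ∑ j, |ξ i j| + ∑ i, ∑ j, |M i j|) := fun M => by
    have h1 : m₀ ≤ f (ξ + M) := hm₀ ⟨_, rfl⟩
    have h2 : matrixNorm (ξ + M) ≤ ∑ i, ∑ j, |ξ i j| + ∑ i, ∑ j, |M i j| := by
      refine (matrixNorm_le_sum_abs _).trans ?_
      simp_rw [← Finset.sum_add_distrib]
      exact Finset.sum_le_sum fun i _ => Finset.sum_le_sum fun j _ => abs_add_le _ _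
    have h3 : f (ξ + M) ≤ L * (1 + ∑ i, ∑ j, |ξ i j| + ∑ i, ∑ j, |M i j|) :=
      (hL _).trans (mul_le_mul_of_nonneg_left (by linarith) hL0)
    have h4 : 0 ≤ L * (1 + ∑ i, ∑ j, |ξ i j| + ∑ i, ∑ j, |M i j|) := by positivity
    rw [abs_le]
    constructor <;> linarith [neg_abs_le m₀, abs_nonneg m₀]
  have hint : ∀ G' : EuclideanSpace ℝ (Fin n) → Matrix (Fin N) (Fin n) ℝ,
      (∀ i j, Integrable (fun x => G' x i j) μ) → Integrable (fun x => f (ξ + G' x)) μ := by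
    intro G' hG'
    refine Integrable.mono' (g := fun x =>
        |m₀| + L * (1 + ∑ i, ∑ j, |ξ i j| + ∑ i, ∑ j, |G' x i j|)) ?_
      (aestronglyMeasurable_comp_matrix hf ξ fun i j => (hG' i j).1)
      (Eventually.of_forall fun x => hbound _)
    exact (integrable_const _).add (((integrable_const _).add (integrable_finsetSum _ fun i _ =>
      integrable_finsetSum _ fun j _ => (hG' i j).abs)).const_mul L)
  rw [extIntegral_eq_coe_integral (hint G hGi), EReal.coe_le_coe_iff]
  -- The geometric rate makes the gradient errors summable in `L^1`. Their sum is then an integrable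
  -- majorant, and pointwise convergence almost everywhere follows without passing to a subsequence.
  choose ψ hψ _ hψ2 using fun k : ℕ =>
    hφ.exists_approx ((1 / 2 : ℝ≥0∞) ^ k) (ENNReal.pow_pos (by simp) k)
  have hJi : ∀ k i j, Integrable (fun x => jacobian (ψ k) x i j) μ := fun k i j =>
    (((hψ k).continuous_jacobian_apply i j).integrable_of_hasCompactSupport
      ((hψ k).hasCompactSupport_jacobian_apply i j)).restrict
  set D : ℕ → EuclideanSpace ℝ (Fin n) → ℝ≥0∞ := fun k x =>
    ∑ i, ∑ j, ‖G x i j - jacobian (ψ k) x i j‖ₑ with hD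
  have hDij : ∀ k i j, AEMeasurable (fun x => ‖G x i j - jacobian (ψ k) x i j‖ₑ) μ :=
    fun k i j => ((hGi i j).1.sub (hJi k i j).1).enorm
  have hDm : ∀ k, AEMeasurable (D k) μ := fun k =>
    Finset.aemeasurable_fun_sum _ fun i _ => Finset.aemeasurable_fun_sum _ fun j _ => hDij k i j
  have hDle : ∀ k, ∫⁻ x, D k x ∂μ ≤ (N * n : ℝ≥0∞) * (1 / 2) ^ k := fun k => by
    rw [hD]
    simp only
    rw [lintegral_finsetSum' _ fun i _ => Finset.aemeasurable_fun_sum _ fun j _ => hDij k i j]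
    simp_rw [lintegral_finsetSum' _ fun j _ => hDij k _ j]
    refine (Finset.sum_le_sum fun i _ => Finset.sum_le_sum fun j _ =>
      (show _ ≤ (1 / 2 : ℝ≥0∞) ^ k from ?_)).trans (le_of_eq (by simp [mul_assoc]))
    have := (hψ2 k i j).le
    rwa [eLpNorm_one_eq_lintegral_enorm] at this
  have hsum : ∫⁻ x, ∑' k, D k x ∂μ ≠ ⊤ := by
    rw [lintegral_tsum hDm]
    refine ne_top_of_le_ne_top ?_ (ENNReal.tsum_le_tsum hDle)
    rw [ENNReal.tsum_mul_left, ENNReal.tsum_geometric]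
    refine ENNReal.mul_ne_top (by finiteness) ?_
    simp
  have hsm : AEMeasurable (fun x => ∑' k, D k x) μ := AEMeasurable.tsum hDm
  have hfin : ∀ᵐ x ∂μ, ∑' k, D k x < ⊤ := ae_lt_top' hsm hsum
  have hij : ∀ k x i j, ‖G x i j - jacobian (ψ k) x i j‖ₑ ≤ D k x := fun k x i j =>
    (Finset.single_le_sum (f := fun j => ‖G x i j - jacobian (ψ k) x i j‖ₑ)
      (fun _ _ => zero_le) (Finset.mem_univ j)).trans
      (Finset.single_le_sum (f := fun i => ∑ j, ‖G x i j - jacobian (ψ k) x i j‖ₑ)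
        (fun _ _ => zero_le) (Finset.mem_univ i))
  -- Continuity of `f` gives pointwise convergence. Linear growth together with the lower bound
  -- dominates the integrands by an `L^1` function built from `G` and the summed errors.
  have hlim : Tendsto (fun k => ∫ x, f (ξ + jacobian (ψ k) x) ∂μ) atTop
      (𝓝 (∫ x, f (ξ + G x) ∂μ)) := by
    refine tendsto_integral_of_dominated_convergence (fun x => |m₀| + L * (1 + ∑ i, ∑ j, |ξ i j| +
      ∑ i, ∑ j, (|G x i j| + (∑' k, D k x).toReal))) (fun k => (hint _ (hJi k)).1) ?_
      (fun k => ?_) ?_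
    · exact (integrable_const _).add (((integrable_const _).add (integrable_finsetSum _ fun i _ =>
        integrable_finsetSum _ fun j _ => (hGi i j).abs.add
          (integrable_toReal_of_lintegral_ne_top hsm hsum))).const_mul L)
    · filter_upwards [hfin] with x hx
      refine (hbound _).trans (add_le_add le_rfl (mul_le_mul_of_nonneg_left
        (add_le_add le_rfl (Finset.sum_le_sum fun i _ => Finset.sum_le_sum fun j _ => ?_)) hL0))
      have h1 : |G x i j - jacobian (ψ k) x i j| ≤ (∑' k, D k x).toReal := by
        rw [← Real.norm_eq_abs, ← toReal_enorm]
        exact ENNReal.toReal_mono hx.ne ((hij k x i j).trans (ENNReal.le_tsum k))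
      have h2 := abs_sub_abs_le_abs_sub (jacobian (ψ k) x i j) (G x i j)
      rw [abs_sub_comm] at h2
      linarith
    · filter_upwards [hfin] with x hx
      have h0 : Tendsto (fun k => D k x) atTop (𝓝 0) :=
        ENNReal.tendsto_atTop_zero_of_tsum_ne_top hx.ne
      have h1 : Tendsto (fun k => jacobian (ψ k) x) atTop (𝓝 (G x)) := by
        refine tendsto_pi_nhds.2 fun i => tendsto_pi_nhds.2 fun j => ?_
        rw [tendsto_iff_edist_tendsto_0]
        refine tendsto_of_tendsto_of_tendsto_of_le_of_le tendsto_const_nhds h0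
          (fun _ => zero_le) fun k => ?_
        simp only
        rw [edist_comm, edist_eq_enorm_sub]
        exact hij k x i j
      exact (hf.tendsto _).comp (h1.const_add ξ)
  refine ge_of_tendsto' hlim fun k => ?_
  -- Smooth test maps belong to `W^{1,p}_0` for every `p ≥ 1`, so the hypothesis for the given `p`
  -- applies to each of them.
  have key := hΩqc (ψ k) (jacobian (ψ k)) ((hψ k).memW1pZero hp1 hΩb)
  rwa [extIntegral_eq_coe_integral (hint _ (hJi k)), EReal.coe_le_coe_iff] at key

end Quasiconvexity

theorem theorem1 {n N : ℕ} (p : ℝ≥0∞) (hp1 : 1 ≤ p) (hp2 : p < 2)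
    (f : Matrix (Fin N) (Fin n) ℝ → ℝ) (hf_cont : Continuous f)
    (hf_bdd : BddBelow (range f)) (hf_qc : IsW1pQuasiconvex p f)
    (L : ℝ) (hL : ∀ ξ : Matrix (Fin N) (Fin n) ℝ, ξ.rank ≤ 1 → f ξ ≤ L * (1 + matrixNorm ξ)) :
    (∃ L' : ℝ, ∀ ξ : Matrix (Fin N) (Fin n) ℝ, f ξ ≤ L' * (1 + matrixNorm ξ)) ∧
      IsW1pQuasiconvex 1 f := by
  obtain ⟨L', hL'0, hL'⟩ := hf_qc.exists_linear_growth hp1 hp2 hf_cont hL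
  exact ⟨⟨L', hL'⟩, hf_qc.one_of_linear_growth hp1 hf_cont hL'0 hL'⟩
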